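/- Setting. Fix $D\ge 2$. Qubits sit on the sites of the cubic lattice $\Lambda=[1,L]^D$, one per site, $n=L^D$. The Pauli group $\mathcal P(n)$ consists of all operators $\gamma P_1\otimes\cdots\otimes P_n$ with $P_a\in\{I,X,Y,Z\}$, $|\gamma|=1$. A stabilizer code is given by an abelian group $\mathcal S\subseteq\mathcal P(n)$ with $-I\notin\mathcal S$; its codespace $\mathcal C$ is the space of vectors fixed by every element of $\mathcal S$, and its logical operators are the unitaries preserving $\mathcal C$. The code has generators of range $\xi$ if $\mathcal S$ is generated by elements whose supports have diameter at most $\xi$. It has distance (at least) $d$ if every logical Pauli operator supported on fewer than $d$ qubits acts on $\mathcal C$ as a multiple of the identity. An encoding of $k$ logical qubits is an isometry $J:(\mathbb C^2)^{\otimes k}\to(\mathbb C^2)^{\otimes n}$ with image $\mathcal C$ such that $\{J^\dagger PJ : P \text{ a logical Pauli operator}\}$ is exactly the $k$-qubit Pauli group $\mathcal P_1$. For $j\ge2$ let $\mathcal P_j=\{U\in U(2^k): U\mathcal P_1U^\dagger\subseteq\mathcal P_{j-1}\}$; $\mathcal P_2$ is the Clifford group (the normalizer of $\mathcal P_1$ in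 $U(2^k)$). A circuit of depth $h$ and range $r$ is a product of $h$ layers, each a product of unitary gates with pairwise disjoint supports of diameter at most $r$. A morphism from a code with codespace $\mathcal C_1$ to a code with codespace $\mathcal C_2$ (on the same lattice) is a unitary $U$ with $U\mathcal C_1=\mathcal C_2$; given encodings $J_1,J_2$ of $k$ qubits, it is a $\mathcal P_j$-morphism if $J_2^\dagger UJ_1\in\mathcal P_j$. A $D$-dimensional topological stabilizer code (TSC) is a family of stabilizer codes on lattices $[1,L_m]^D$ with $L_m\to\infty$, with generators of range $\xi$ independent of $m$, and with distance tending to infinity. Theorem. (1) There is a constant $C$ depending only on $D$ such that the following holds for all $L,\xi,h,r,d$. Let $\mathcal S_1,\mathcal S_2$ be stabilizer codes on $[1,L]^D$ with generators of range $\xi$ and distance at least $d$, where $C\,(\xi+hr+1)^D\le d$, and let $J_1,J_2$ be encodings of $k$ qubits for them. If a morphism $U$ from $\mathcal S_1$ to $\mathcal S_2$ is implemented by a circuit of depth $h$ and range $r$, then $J_2^\dagger UJ_1\in\mathcal P_D$, i.e. $U$ is a $\mathcal P_D$-morphism. For $D=2$, $J_2^\dagger U J_1$ is a Clifford gate. (2)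 Let $\mathcal S_1,\mathcal S_2$ be two $D$-dimensional TSCs on the same lattices, and fix $h$ and $r$. For all large enough $m$, whenever the $m$-th codes are given encodings of the same number of qubits, every morphism from the $m$-th code of $\mathcal S_1$ to the $m$-th code of $\mathcal S_2$ that is implemented by a circuit of depth $h$ and range $r$ is a $\mathcal P_D$-morphism (for $D=2$, it implements a Clifford gate). (3) In particular, for one $D$-dimensional TSC and fixed $h,r$: for all large enough $m$ and every encoding $J$ of the $m$-th code, every unitary $U$ that preserves its codespace and is implemented by a circuit of depth $h$ and range $r$ satisfies $J^\dagger UJ\in\mathcal P_D$ (for $D=2$, it is a Clifford gate). -/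

import Mathlib

open Filter
open scoped Matrix

namespace LocalStab

/-! ### Operators on finitely many qubits -/

/-- Labels of the computational basis of a system of qubits indexed by `Q`. -/
abbrev Bits (Q : Type) : Type := Q → Fin 2

/-- Linear operators on the Hilbert space `(ℂ²)^{⊗Q}`, as matrices in the computational basis. -/
abbrev Op (Q : Type) : Type := Matrix (Bits Q) (Bits Q) ℂ

section Qubits

variable {Q : Type} [Fintype Q] [DecidableEq Q]

/-- The operator `O` acts trivially on qubit `a`, that is, `O = I_a ⊗ O'` for an operator `O'` on
the remaining qubits: matrix entries between basis states that differ at `a` vanish, and the other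
entries do not depend on the common value at `a`. -/
def ActsTriviallyAt (O : Op Q) (a : Q) : Prop :=
  ∀ x y : Bits Q, (x a ≠ y a → O x y = 0) ∧
    (x a = y a → ∀ s : Fin 2, O (Function.update x a s) (Function.update y a s) = O x y)

/-- The support of an operator: the set of qubits on which it acts non-trivially. -/
def supp (O : Op Q) : Set Q := {a | ¬ ActsTriviallyAt O a}

/-- The labels of the four single-qubit Pauli operators. -/
inductive PauliLetter : Type
  | I
  | X
  | Y
  | Z

/-- The single-qubit Pauli matrices. -/
noncomputable def PauliLetter.toMatrix : PauliLetter → Matrix (Fin 2) (Fin 2) ℂ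
  | PauliLetter.I => 1
  | PauliLetter.X => !![0, 1; 1, 0]
  | PauliLetter.Y => !![0, -Complex.I; Complex.I, 0]
  | PauliLetter.Z => !![1, 0; 0, -1]

/-- The tensor product `⊗_a A_a` of single-qubit operators. -/
noncomputable def tensorOp (A : Q → Matrix (Fin 2) (Fin 2) ℂ) : Op Q :=
  Matrix.of fun x y => ∏ a, A a (x a) (y a)

variable (Q) in
/-- The Pauli group: all operators `γ ⊗_a P_a` with `P_a ∈ {I, X, Y, Z}` and `|γ| = 1`. -/
def pauliGroup : Set (Op Q) :=
  {M | ∃ (γ : ℂ) (P : Q → PauliLetter), ‖γ‖ = 1 ∧ M = γ • tensorOp fun a => (P a).toMatrix}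

variable (Q) in
/-- The levels `𝒫_j`, `j ≥ 1`, of the Clifford hierarchy (level `0` is not used): `𝒫_1` is the
Pauli group, and for `j ≥ 2` the set `𝒫_j` consists of the unitaries `U` with
`U 𝒫_1 U† ⊆ 𝒫_{j-1}`. -/
def cliffordLevel : ℕ → Set (Op Q)
  | 0 => ∅
  | 1 => pauliGroup Q
  | j + 2 => {U | U ∈ Matrix.unitaryGroup (Bits Q) ℂ ∧
      ∀ P ∈ pauliGroup Q, U * P * Uᴴ ∈ cliffordLevel (j + 1)}

variable (Q) in
/-- The Clifford group: the normalizer of the Pauli group in the unitary group. -/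
def cliffordGroup : Set (Op Q) :=
  {U | U ∈ Matrix.unitaryGroup (Bits Q) ℂ ∧
    (fun P => U * P * Uᴴ) '' pauliGroup Q = pauliGroup Q}

/-! ### Stabilizer codes -/

variable (Q) in
/-- A stabilizer code: an abelian group of Pauli operators not containing `-I`. -/
structure StabilizerCode where
  /-- the stabilizer group -/
  group : Subgroup (Matrix.unitaryGroup (Bits Q) ℂ)
  isPauli : ∀ s ∈ group, (s : Op Q) ∈ pauliGroup Q
  commute : ∀ s ∈ group, ∀ t ∈ group, s * t = t * s
  neg_one_notMem : -1 ∉ group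

/-- The codespace: all vectors fixed by every stabilizer. -/
def StabilizerCode.codespace (S : StabilizerCode Q) : Submodule ℂ (Bits Q → ℂ) where
  carrier := {ψ | ∀ s ∈ S.group, (s : Op Q) *ᵥ ψ = ψ}
  add_mem' := by
    intro ψ φ hψ hφ s hs
    rw [Matrix.mulVec_add, hψ s hs, hφ s hs]
  zero_mem' := by
    intro s _
    exact Matrix.mulVec_zero _
  smul_mem' := by
    intro c ψ hψ s hs
    rw [Matrix.mulVec_smul, hψ s hs]

/-- `U` is a morphism of codes: a unitary that maps the codespace of `S₁` onto that of `S₂`,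
equivalently `U Π₁ U† = Π₂` for the projectors onto the codespaces. -/
def IsMorphism (S₁ S₂ : StabilizerCode Q) (U : Op Q) : Prop :=
  U ∈ Matrix.unitaryGroup (Bits Q) ℂ ∧
    S₁.codespace.map (Matrix.mulVecLin U) = S₂.codespace

/-- Logical operators of a code: the unitaries that preserve its codespace. -/
def StabilizerCode.IsLogical (S : StabilizerCode Q) (O : Op Q) : Prop := IsMorphism S S O

/-- The code has distance (at least) `d`: every logical Pauli operator supported on fewer than `d`
qubits acts on the codespace as a multiple of the identity. -/
def StabilizerCode.HasDistance (S : StabilizerCode Q) (d : ℕ) : Prop :=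
  ∀ P ∈ pauliGroup Q, S.IsLogical P → (supp P).ncard < d →
    ∃ c : ℂ, ∀ ψ ∈ S.codespace, P *ᵥ ψ = c • ψ

/-- An encoding of `k` logical qubits, that is, a choice of basis of the codespace: an isometry `J`
from `(ℂ²)^{⊗k}` onto the codespace such that the encoded operators `J† P J` of the logical Pauli
operators `P` are exactly the `k`-qubit Pauli operators. -/
def StabilizerCode.IsEncoding (S : StabilizerCode Q) {k : ℕ}
    (J : Matrix (Bits Q) (Bits (Fin k)) ℂ) : Prop :=
  Jᴴ * J = 1 ∧ LinearMap.range (Matrix.mulVecLin J) = S.codespace ∧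
    pauliGroup (Fin k) = {A | ∃ P ∈ pauliGroup Q, S.IsLogical P ∧ A = Jᴴ * P * J}

end Qubits

/-! ### Geometry: the cubic lattice, local codes and local circuits -/

/-- The sites of the cubic lattice `[1, L]^D`; each site carries one qubit. -/
abbrev Site (D L : ℕ) : Type := Fin D → Fin L

section Lattice

variable {D L : ℕ}

/-- The distance of two lattice sites (in the maximum norm). -/
def siteDist (a b : Site D L) : ℕ :=
  Finset.univ.sup fun i => ((a i : ℤ) - (b i : ℤ)).natAbs

/-- The set of sites `M` has diameter at most `ρ`. -/
def DiamLE (M : Set (Site D L)) (ρ : ℕ) : Prop :=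
  ∀ a ∈ M, ∀ b ∈ M, siteDist a b ≤ ρ

/-- The stabilizer group is generated by elements whose supports have diameter at most `ξ`. -/
def HasLocalGenerators (S : StabilizerCode (Site D L)) (ξ : ℕ) : Prop :=
  ∃ G : Set (Matrix.unitaryGroup (Bits (Site D L)) ℂ),
    Subgroup.closure G = S.group ∧ ∀ g ∈ G, DiamLE (supp (g : Op (Site D L))) ξ

/-- One layer (time step) of a circuit: a product of unitary gates with pairwise disjoint supports,
each support having diameter at most `r`. -/
def IsLayer (r : ℕ) (V : Op (Site D L)) : Prop :=
  ∃ gates : List (Op (Site D L)),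
    (∀ g ∈ gates, g ∈ Matrix.unitaryGroup (Bits (Site D L)) ℂ ∧ DiamLE (supp g) r) ∧
    gates.Pairwise (fun g g' => Disjoint (supp g) (supp g')) ∧
    V = gates.prod

/-- `U` is implemented by a quantum circuit of depth `h` whose gates have range at most `r`. -/
def IsCircuit (h r : ℕ) (U : Op (Site D L)) : Prop :=
  ∃ layers : List (Op (Site D L)),
    layers.length = h ∧ (∀ V ∈ layers, IsLayer r V) ∧ U = layers.prod

end Lattice

/-- A `D`-dimensional topological stabilizer code: a family of stabilizer codes on cubic lattices of
diverging linear sizes `L m`, with generators of uniformly bounded range and with code distance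
tending to infinity. -/
def IsTopologicalStabilizerCode {D : ℕ} (L : ℕ → ℕ)
    (S : ∀ m, StabilizerCode (Site D (L m))) : Prop :=
  Tendsto L atTop atTop ∧
    (∃ ξ : ℕ, ∀ m, HasLocalGenerators (S m) ξ) ∧
    ∀ d : ℕ, ∀ᶠ m in atTop, (S m).HasDistance d

/-- `U` implements an element of the `j`-th level of the Clifford hierarchy with respect to the
encodings `J₁` (of the source code) and `J₂` (of the target code). For two codes and a morphism `U`
between them, this says that `U` is a `𝒫_j`-morphism. -/
def ImplementsLevel {Q : Type} [Fintype Q] [DecidableEq Q] {k : ℕ}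
    (J₁ J₂ : Matrix (Bits Q) (Bits (Fin k)) ℂ) (U : Op Q) (j : ℕ) : Prop :=
  J₂ᴴ * U * J₁ ∈ cliffordLevel (Fin k) j

end LocalStab

open LocalStab

set_option linter.unusedSectionVars false
set_option linter.unusedTactic false

namespace LocalStab

/-! ### Pauli operators labelled by binary vectors -/

/-! Conjugation by a circuit moves supports by at most `ρ = h * r` (`IsCircuit.spreads`). The
lattice is covered by `D + 1` regions A_0, ..., A_D, each a union of boxes so far apart that even
after thickening no generator meets two of them. A logical Pauli operator on a thickened region
therefore splits into logical pieces on single boxes, and these are scalars by the distance bound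
(`correctable_of_fibers`). Symplectic duality turns this into cleaning: every logical Pauli operator
has a representative that is trivial on a given correctable region (`Correctable.exists_clean`).

Represent an encoded Pauli operator by some P cleaned off a neighbourhood of A_0. Then K = U P U† is
a logical operator of the second code that is trivial on A_0. Its commutator with a Pauli operator
cleaned off a neighbourhood of A_1 is trivial on A_0 and A_1 and spreads twice as far. Iterating,
the last commutator lives on A_D alone, so its encoded action is a scalar (`exists_eq_smul_one`).

A unitary commuting with all Pauli operators up to scalars is a Pauli operator
(`mem_pauliGroup_of_mul_eq_smul`). Going back, each commutator costs one level of the hierarchy,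
because the levels are stable under right multiplication by Pauli operators
(`mul_mem_cliffordLevel`). The induction is `comp_mem_cliffordLevel_of_spreads`; the step from `U`
to K is `implementsLevel_of_spreads`. For `D = 2` the same argument for the adjoint gives the
normalizer condition. -/

/-- The binary label space of single-qubit Pauli operators. -/
abbrev PauliBits : Type := ZMod 2 × ZMod 2

/-- The Pauli letter with a given binary label. -/
def PauliBits.letter (p : PauliBits) : PauliLetter :=
  if p.1 = 0 then (if p.2 = 0 then PauliLetter.I else PauliLetter.Z)
  else (if p.2 = 0 then PauliLetter.X else PauliLetter.Y)

/-- The Pauli matrix with a given binary label. -/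
noncomputable def sigma (p : PauliBits) : Matrix (Fin 2) (Fin 2) ℂ := p.letter.toMatrix

/-- The sign character of `ZMod 2`. -/
noncomputable def chi (c : ZMod 2) : ℂ := if c = 0 then 1 else -1

lemma zmod_two_cases (c : ZMod 2) : c = 0 ∨ c = 1 := by
  revert c; decide

lemma chi_zero : chi 0 = 1 := by simp [chi]

lemma chi_one : chi 1 = -1 := by simp [chi]

lemma chi_add (a b : ZMod 2) : chi (a + b) = chi a * chi b := by
  have h : (1 : ZMod 2) + 1 = 0 := by decide
  rcases zmod_two_cases a with rfl | rfl <;> rcases zmod_two_cases b with rfl | rfl <;>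
    simp [chi, h]

lemma chi_mul_self (a : ZMod 2) : chi a * chi a = 1 := by
  rcases zmod_two_cases a with rfl | rfl <;> simp [chi]

lemma chi_eq_one_iff (a : ZMod 2) : chi a = 1 ↔ a = 0 := by
  rcases zmod_two_cases a with rfl | rfl
  · simp [chi]
  · simp only [chi]; norm_num

/-- The symplectic form on single-qubit labels. -/
def sympl₁ (p q : PauliBits) : ZMod 2 := p.1 * q.2 + p.2 * q.1

lemma sigma_zero : sigma 0 = 1 := by simp [sigma, PauliBits.letter, PauliLetter.toMatrix]

lemma PauliBits.letter_surjective : Function.Surjective PauliBits.letter := by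
  intro l
  cases l
  exacts [⟨(0, 0), by simp [letter]⟩, ⟨(1, 0), by simp [letter]⟩, ⟨(1, 1), by simp [letter]⟩,
    ⟨(0, 1), by simp [letter]⟩]

/-- The label (1, 1) stands for Y and not for XZ, so every `sigma p` is a Hermitian involution and
phases enter only through products. -/
lemma sigma_mul_self (p : PauliBits) : sigma p * sigma p = 1 := by
  obtain ⟨a, b⟩ := p
  rcases zmod_two_cases a with rfl | rfl <;> rcases zmod_two_cases b with rfl | rfl <;>
    ext i j <;> fin_cases i <;> fin_cases j <;>
    simp [sigma, PauliBits.letter, PauliLetter.toMatrix]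

lemma sigma_conjTranspose (p : PauliBits) : (sigma p)ᴴ = sigma p := by
  obtain ⟨a, b⟩ := p
  rcases zmod_two_cases a with rfl | rfl <;> rcases zmod_two_cases b with rfl | rfl <;>
    ext i j <;> fin_cases i <;> fin_cases j <;>
    simp [sigma, PauliBits.letter, PauliLetter.toMatrix]

lemma sigma_mul (p q : PauliBits) :
    ∃ γ : ℂ, ‖γ‖ = 1 ∧ sigma p * sigma q = γ • sigma (p + q) := by
  have h : (1 : ZMod 2) + 1 = 0 := by decide
  obtain ⟨a, b⟩ := p
  obtain ⟨c, d⟩ := q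
  rcases zmod_two_cases a with rfl | rfl <;> rcases zmod_two_cases b with rfl | rfl <;>
  rcases zmod_two_cases c with rfl | rfl <;> rcases zmod_two_cases d with rfl | rfl <;>
  -- Only the phases 1, i and -i occur in a product of two Pauli letters.
  first
  | refine ⟨1, by simp, ?_⟩
    (ext i j; fin_cases i <;> fin_cases j <;>
    simp [sigma, PauliBits.letter, PauliLetter.toMatrix, h]; done)
  | refine ⟨Complex.I, by simp, ?_⟩
    (ext i j; fin_cases i <;> fin_cases j <;>
    simp [sigma, PauliBits.letter, PauliLetter.toMatrix, h]; done)
  | refine ⟨-Complex.I, by simp, ?_⟩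
    (ext i j; fin_cases i <;> fin_cases j <;>
    simp [sigma, PauliBits.letter, PauliLetter.toMatrix, h]; done)

lemma sigma_mul_comm (p q : PauliBits) :
    sigma p * sigma q = chi (sympl₁ p q) • (sigma q * sigma p) := by
  have h : (1 : ZMod 2) + 1 = 0 := by decide
  obtain ⟨a, b⟩ := p
  obtain ⟨c, d⟩ := q
  rcases zmod_two_cases a with rfl | rfl <;> rcases zmod_two_cases b with rfl | rfl <;>
  rcases zmod_two_cases c with rfl | rfl <;> rcases zmod_two_cases d with rfl | rfl <;>
    ext i j <;> fin_cases i <;> fin_cases j <;>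
    simp [sigma, PauliBits.letter, PauliLetter.toMatrix, h, chi, sympl₁]

lemma matrix_eq_sum_sigma (A : Matrix (Fin 2) (Fin 2) ℂ) :
    ∃ c : PauliBits → ℂ, A = ∑ p, c p • sigma p := by
  -- The coefficient of `sigma p` is tr(`sigma p * A`) / 2.
  refine ⟨fun p => if p.1 = 0 then (if p.2 = 0 then (A 0 0 + A 1 1) / 2 else (A 0 0 - A 1 1) / 2)
    else (if p.2 = 0 then (A 0 1 + A 1 0) / 2 else Complex.I * (A 0 1 - A 1 0) / 2), ?_⟩
  have h01 : ∀ f : ZMod 2 → Matrix (Fin 2) (Fin 2) ℂ, ∑ i, f i = f 0 + f 1 :=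
    fun f => Fin.sum_univ_two f
  rw [Fintype.sum_prod_type, h01, h01, h01]
  ext i j
  fin_cases i <;> fin_cases j <;>
    simp [sigma, PauliBits.letter, PauliLetter.toMatrix] <;> ring_nf <;>
    simp [Complex.I_sq] <;> ring

/-- A nontrivial character of a finite group sums to zero. -/
lemma sum_chi_sympl₁ {q : PauliBits} (hq : q ≠ 0) : ∑ p, chi (sympl₁ p q) = 0 := by
  have h : (1 : ZMod 2) + 1 = 0 := by decide
  have h01 : ∀ f : ZMod 2 → ℂ, ∑ i, f i = f 0 + f 1 := fun f => Fin.sum_univ_two f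
  rw [Fintype.sum_prod_type, h01, h01, h01]
  obtain ⟨a, b⟩ := q
  rcases zmod_two_cases a with rfl | rfl <;> rcases zmod_two_cases b with rfl | rfl <;>
    simp_all [chi, sympl₁]

variable {Q : Type} [Fintype Q] [DecidableEq Q]

lemma tensorOp_mul (A B : Q → Matrix (Fin 2) (Fin 2) ℂ) :
    tensorOp A * tensorOp B = tensorOp fun a => A a * B a := by
  ext x y
  simp only [tensorOp, Matrix.mul_apply, Matrix.of_apply]
  rw [Finset.prod_univ_sum, Fintype.piFinset_univ]
  exact Finset.sum_congr rfl fun z _ => Finset.prod_mul_distrib.symm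

lemma tensorOp_smul (c : Q → ℂ) (A : Q → Matrix (Fin 2) (Fin 2) ℂ) :
    (tensorOp fun a => c a • A a) = (∏ a, c a) • tensorOp A := by
  ext x y
  simp [tensorOp, Finset.prod_mul_distrib]

lemma tensorOp_one : tensorOp (fun _ : Q => (1 : Matrix (Fin 2) (Fin 2) ℂ)) = 1 := by
  ext x y
  simp only [tensorOp, Matrix.of_apply, Matrix.one_apply]
  by_cases h : x = y
  · simp [h]
  · rw [if_neg h]
    obtain ⟨a, ha⟩ := Function.ne_iff.1 h
    exact Finset.prod_eq_zero (Finset.mem_univ a) (if_neg ha)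

lemma tensorOp_conjTranspose (A : Q → Matrix (Fin 2) (Fin 2) ℂ) :
    (tensorOp A)ᴴ = tensorOp fun a => (A a)ᴴ := by
  ext x y
  simp [tensorOp, Matrix.conjTranspose_apply]

/-- The space of binary labels of Pauli operators. -/
abbrev PauliLabel (Q : Type) : Type := Q → PauliBits

/-- The Pauli operator with a given binary label. -/
noncomputable def pauliOp (v : PauliLabel Q) : Op Q := tensorOp fun a => sigma (v a)

/-- The symplectic form on labels of Pauli operators. -/
def sympl (v w : PauliLabel Q) : ZMod 2 := ∑ a, sympl₁ (v a) (w a)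

lemma mem_pauliGroup_iff {M : Op Q} :
    M ∈ pauliGroup Q ↔ ∃ (γ : ℂ) (v : PauliLabel Q), ‖γ‖ = 1 ∧ M = γ • pauliOp v := by
  constructor
  · rintro ⟨γ, P, hγ, rfl⟩
    choose v hv using fun a => PauliBits.letter_surjective (P a)
    exact ⟨γ, v, hγ, by simp [pauliOp, sigma, hv]⟩
  · rintro ⟨γ, v, hγ, rfl⟩
    exact ⟨γ, fun a => (v a).letter, hγ, rfl⟩

lemma pauliOp_mem (v : PauliLabel Q) : pauliOp v ∈ pauliGroup Q :=
  mem_pauliGroup_iff.2 ⟨1, v, by simp, by simp⟩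

lemma pauliOp_zero : pauliOp (0 : PauliLabel Q) = 1 := by
  simp only [pauliOp, Pi.zero_apply, sigma_zero, tensorOp_one]

lemma pauliOp_mul_self (v : PauliLabel Q) : pauliOp v * pauliOp v = 1 := by
  simp only [pauliOp, tensorOp_mul, sigma_mul_self, tensorOp_one]

lemma pauliOp_conjTranspose (v : PauliLabel Q) : (pauliOp v)ᴴ = pauliOp v := by
  simp only [pauliOp, tensorOp_conjTranspose, sigma_conjTranspose]

lemma pauliOp_mul (v w : PauliLabel Q) :
    ∃ γ : ℂ, ‖γ‖ = 1 ∧ pauliOp v * pauliOp w = γ • pauliOp (v + w) := by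
  choose γ hγ h using fun a => sigma_mul (v a) (w a)
  exact ⟨∏ a, γ a, by simp [norm_prod, hγ], by
    simp only [pauliOp, tensorOp_mul, h, tensorOp_smul, Pi.add_apply]⟩

lemma chi_sum {ι : Type*} (s : Finset ι) (f : ι → ZMod 2) :
    chi (∑ i ∈ s, f i) = ∏ i ∈ s, chi (f i) := by
  classical
  induction s using Finset.induction_on with
  | empty => simp [chi_zero]
  | insert a s ha ih => rw [Finset.sum_insert ha, Finset.prod_insert ha, chi_add, ih]

lemma pauliOp_mul_comm (v w : PauliLabel Q) :
    pauliOp v * pauliOp w = chi (sympl v w) • (pauliOp w * pauliOp v) := by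
  simp only [pauliOp, tensorOp_mul, sympl, chi_sum, ← tensorOp_smul, ← sigma_mul_comm]

lemma pauliOp_ne_zero (v : PauliLabel Q) : pauliOp v ≠ 0 := by
  intro h
  have := pauliOp_mul_self v
  rw [h, zero_mul] at this
  exact zero_ne_one this

lemma commute_pauliOp_iff {v w : PauliLabel Q} :
    Commute (pauliOp v) (pauliOp w) ↔ sympl v w = 0 := by
  rw [commute_iff_eq, ← chi_eq_one_iff]
  constructor
  · intro h
    have h2 := pauliOp_mul_comm v w
    rw [h] at h2
    have h3 : (1 - chi (sympl v w)) • (pauliOp w * pauliOp v) = 0 := by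
      rw [sub_smul, ← h2, one_smul, sub_self]
    rcases smul_eq_zero.1 h3 with h4 | h4
    · exact (sub_eq_zero.1 h4).symm
    · have h5 : pauliOp w * (pauliOp w * pauliOp v) = 0 := by rw [h4, mul_zero]
      rw [← mul_assoc, pauliOp_mul_self, one_mul] at h5
      exact absurd h5 (pauliOp_ne_zero v)
  · intro h
    rw [pauliOp_mul_comm, h, one_smul]

lemma sympl_comm (v w : PauliLabel Q) : sympl v w = sympl w v := by
  simp only [sympl, sympl₁]
  exact Finset.sum_congr rfl fun a _ => by ring

lemma sympl_single (a : Q) (p : PauliBits) (v : PauliLabel Q) :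
    sympl (Pi.single a p) v = sympl₁ p (v a) := by
  rw [sympl, Finset.sum_eq_single a]
  · simp
  · intro b _ hb
    simp [hb, sympl₁]
  · simp

lemma sympl_eq_zero_of_disjoint {v w : PauliLabel Q} (h : ∀ a, v a = 0 ∨ w a = 0) :
    sympl v w = 0 := by
  refine Finset.sum_eq_zero fun a _ => ?_
  rcases h a with h | h <;> simp [h, sympl₁]

/-- A matrix unit is a tensor product of single-qubit matrix units; expanding each factor in the
`sigma p` and multiplying out gives Pauli operators. -/
lemma span_pauliOp : Submodule.span ℂ (Set.range (pauliOp (Q := Q))) = ⊤ := by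
  have key : ∀ A : Q → Matrix (Fin 2) (Fin 2) ℂ,
      tensorOp A ∈ Submodule.span ℂ (Set.range (pauliOp (Q := Q))) := by
    intro A
    choose c hc using fun a => matrix_eq_sum_sigma (A a)
    have : tensorOp A = ∑ v : PauliLabel Q, (∏ a, c a (v a)) • pauliOp v := by
      ext x y
      simp only [tensorOp, Matrix.of_apply, Matrix.sum_apply, Matrix.smul_apply, pauliOp,
        smul_eq_mul]
      have h1 : ∀ a, A a (x a) (y a) = ∑ p, c a p * sigma p (x a) (y a) := by
        intro a
        conv_lhs => rw [hc a]
        simp [Matrix.sum_apply]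
      simp only [h1]
      rw [Finset.prod_univ_sum, Fintype.piFinset_univ]
      exact Finset.sum_congr rfl fun z _ => Finset.prod_mul_distrib
    rw [this]
    exact Submodule.sum_mem _ fun v _ => Submodule.smul_mem _ _ (Submodule.subset_span ⟨v, rfl⟩)
  rw [eq_top_iff]
  intro O _
  rw [Matrix.matrix_eq_sum_single O]
  refine Submodule.sum_mem _ fun x _ => Submodule.sum_mem _ fun y _ => ?_
  have h : Matrix.single x y (O x y) = O x y •
      tensorOp fun a => Matrix.single (x a) (y a) (1 : ℂ) := by
    ext x' y'
    simp only [Matrix.single_apply, Matrix.smul_apply, tensorOp, Matrix.of_apply, smul_eq_mul]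
    by_cases hxy : x = x' ∧ y = y'
    · obtain ⟨rfl, rfl⟩ := hxy
      simp
    · rw [if_neg hxy]
      have : ∃ a, ¬ (x a = x' a ∧ y a = y' a) := by
        by_contra hcon
        push Not at hcon
        exact hxy ⟨funext fun a => (hcon a).1, funext fun a => (hcon a).2⟩
      obtain ⟨a, ha⟩ := this
      rw [Finset.prod_eq_zero (Finset.mem_univ a) (if_neg ha), mul_zero]
  rw [h]
  exact Submodule.smul_mem _ _ (key _)

/-! ### Supports of operators -/

lemma pauliOp_single_apply (a : Q) (p : PauliBits) (x y : Bits Q) :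
    pauliOp (Pi.single a p) x y =
      if ∀ b, b ≠ a → x b = y b then sigma p (x a) (y a) else 0 := by
  simp only [pauliOp, tensorOp, Matrix.of_apply]
  split_ifs with h
  · rw [Finset.prod_eq_single a]
    · simp
    · intro b _ hb
      simp [hb, sigma_zero, h b hb]
    · simp
  · push Not at h
    obtain ⟨b, hb, hxy⟩ := h
    refine Finset.prod_eq_zero (Finset.mem_univ b) ?_
    simp [hb, sigma_zero, hxy]

lemma sum_eq_sum_update (x : Bits Q) (a : Q) (f : Bits Q → ℂ)
    (hf : ∀ z, (¬ ∀ b, b ≠ a → z b = x b) → f z = 0) :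
    ∑ z, f z = ∑ s : Fin 2, f (Function.update x a s) := by
  rw [← Finset.sum_image (s := Finset.univ) (g := fun s => Function.update x a s) (f := f)
    (Function.update_injective x a).injOn]
  symm
  refine Finset.sum_subset (Finset.subset_univ _) fun z _ hz => hf z fun h => hz ?_
  refine Finset.mem_image.2 ⟨z a, Finset.mem_univ _, ?_⟩
  ext b
  by_cases hb : b = a
  · subst hb; simp
  · simp [hb, h b hb]

lemma mul_pauliOp_single_apply (O : Op Q) (a : Q) (p : PauliBits) (x y : Bits Q) :
    (O * pauliOp (Pi.single a p)) x y =
      ∑ s : Fin 2, O x (Function.update y a s) * sigma p s (y a) := by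
  rw [Matrix.mul_apply, sum_eq_sum_update y a]
  · refine Finset.sum_congr rfl fun s _ => ?_
    rw [pauliOp_single_apply, if_pos]
    · simp
    · intro b hb; simp [hb]
  · intro z hz
    rw [pauliOp_single_apply, if_neg hz, mul_zero]

lemma pauliOp_single_mul_apply (O : Op Q) (a : Q) (p : PauliBits) (x y : Bits Q) :
    (pauliOp (Pi.single a p) * O) x y =
      ∑ s : Fin 2, sigma p (x a) s * O (Function.update x a s) y := by
  rw [Matrix.mul_apply, sum_eq_sum_update x a]
  · refine Finset.sum_congr rfl fun s _ => ?_
    rw [pauliOp_single_apply, if_pos]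
    · simp
    · intro b hb; simp [hb]
  · intro z hz
    rw [pauliOp_single_apply, if_neg, zero_mul]
    exact fun h => hz fun b hb => (h b hb).symm

/-- Commuting with Z at `a` kills the entries between states differing at `a`; commuting with X
equates the two remaining blocks. This replaces the entrywise definition of support by a condition
stable under products and adjoints. -/
lemma actsTriviallyAt_iff_commute {O : Op Q} {a : Q} :
    ActsTriviallyAt O a ↔ ∀ p, Commute O (pauliOp (Pi.single a p)) := by
  constructor
  · intro h p
    ext x y
    rw [mul_pauliOp_single_apply, pauliOp_single_mul_apply,
      Finset.sum_eq_single (x a) _ (by simp), Finset.sum_eq_single (y a) _ (by simp)]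
    · have h1 := (h x (Function.update y a (x a))).2 (by simp) (y a)
      rw [Function.update_idem, Function.update_eq_self] at h1
      rw [h1, mul_comm]
    · intro s _ hs
      rw [(h _ _).1 (by simpa using hs), mul_zero]
    · intro s _ hs
      rw [(h _ _).1 (by simpa using hs.symm), zero_mul]
  · intro h x y
    have hX : ∀ x y : Bits Q, ∑ s : Fin 2, O x (Function.update y a s) * sigma (1, 0) s (y a) =
        ∑ s : Fin 2, sigma (1, 0) (x a) s * O (Function.update x a s) y := by
      intro x y
      rw [← mul_pauliOp_single_apply, ← pauliOp_single_mul_apply, (h _).eq]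
    have hZ : ∀ x y : Bits Q, ∑ s : Fin 2, O x (Function.update y a s) * sigma (0, 1) s (y a) =
        ∑ s : Fin 2, sigma (0, 1) (x a) s * O (Function.update x a s) y := by
      intro x y
      rw [← mul_pauliOp_single_apply, ← pauliOp_single_mul_apply, (h _).eq]
    have two : ∀ s : Fin 2, s = 0 ∨ s = 1 := by decide
    constructor
    · intro hxy
      have h1 := hZ x y
      have hx := Function.update_eq_self a x
      have hy := Function.update_eq_self a y
      rcases two (x a) with hxa | hxa <;> rcases two (y a) with hya | hya <;>
        simp only [hxa, hya] at h1 hxy hx hy <;>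
        simp [sigma, PauliBits.letter, PauliLetter.toMatrix, hx, hy] at h1 hxy
      · linear_combination (-1 / 2 : ℂ) * h1
      · linear_combination (1 / 2 : ℂ) * h1
    · intro hxy s
      by_cases hs : s = x a
      · rw [hs, Function.update_eq_self, hxy, Function.update_eq_self]
      have h1 := hX x (Function.update y a s)
      have hx := Function.update_eq_self a x
      have hy := Function.update_eq_self a y
      rcases two (x a) with hxa | hxa <;> rcases two s with rfl | rfl <;>
        simp only [hxa, ← hxy] at h1 hs hx hy <;>
        simp [sigma, PauliBits.letter, PauliLetter.toMatrix, hy] at h1 hs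
      · exact h1.symm
      · exact h1.symm

lemma notMem_supp_iff {O : Op Q} {a : Q} :
    a ∉ supp O ↔ ∀ p, Commute O (pauliOp (Pi.single a p)) := by
  rw [← actsTriviallyAt_iff_commute]
  simp [supp]

lemma supp_mul_subset (A B : Op Q) : supp (A * B) ⊆ supp A ∪ supp B := by
  intro a ha
  by_contra h
  simp only [Set.mem_union, not_or, notMem_supp_iff] at h
  exact notMem_supp_iff.2 (fun p => (h.1 p).mul_left (h.2 p)) ha

lemma supp_conjTranspose (A : Op Q) : supp Aᴴ = supp A := by
  have key : ∀ A : Op Q, supp Aᴴ ⊆ supp A := by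
    intro A a ha
    by_contra h
    rw [notMem_supp_iff] at h
    refine notMem_supp_iff.2 (fun p => ?_) ha
    have := congrArg Matrix.conjTranspose (h p).eq
    simp only [Matrix.conjTranspose_mul, pauliOp_conjTranspose] at this
    exact this.symm
  refine (key A).antisymm ?_
  have := key Aᴴ
  rwa [Matrix.conjTranspose_conjTranspose] at this

lemma supp_smul_subset (c : ℂ) (A : Op Q) : supp (c • A) ⊆ supp A := by
  intro a ha
  by_contra h
  rw [notMem_supp_iff] at h
  exact notMem_supp_iff.2 (fun p => (h p).smul_left c) ha

lemma sympl₁_nondegenerate {q : PauliBits} (h : ∀ p, sympl₁ p q = 0) : q = 0 := by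
  have h1 := h (1, 0)
  have h2 := h (0, 1)
  simp [sympl₁] at h1 h2
  exact Prod.ext h2 h1

lemma mem_supp_pauliOp {v : PauliLabel Q} {a : Q} : a ∈ supp (pauliOp v) ↔ v a ≠ 0 := by
  rw [← not_iff_not, notMem_supp_iff, not_not]
  simp only [commute_pauliOp_iff, sympl_comm v, sympl_single]
  exact ⟨sympl₁_nondegenerate, fun h p => by simp [h, sympl₁]⟩

/-- The average of the conjugates of an operator by the Pauli operators at a site. -/
noncomputable def twirl (a : Q) : Op Q →ₗ[ℂ] Op Q :=
  (1 / 4 : ℂ) • ∑ p : PauliBits,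
    (LinearMap.mulLeft ℂ (pauliOp (Pi.single a p))).comp
      (LinearMap.mulRight ℂ (pauliOp (Pi.single a p)))

lemma twirl_apply (a : Q) (O : Op Q) : twirl a O =
    (1 / 4 : ℂ) • ∑ p, pauliOp (Pi.single a p) * (O * pauliOp (Pi.single a p)) := by
  simp [twirl]

lemma twirl_eq_self {a : Q} {O : Op Q} (h : a ∉ supp O) : twirl a O = O := by
  rw [notMem_supp_iff] at h
  rw [twirl_apply]
  simp only [(h _).eq, ← mul_assoc, pauliOp_mul_self, one_mul]
  have : Fintype.card PauliBits = 4 := rfl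
  rw [Finset.sum_const, Finset.card_univ, this, ← Nat.cast_smul_eq_nsmul ℂ, smul_smul]
  norm_num

lemma twirl_pauliOp_eq_zero {a : Q} {v : PauliLabel Q} (h : v a ≠ 0) :
    twirl a (pauliOp v) = 0 := by
  rw [twirl_apply]
  have : ∀ p, pauliOp (Pi.single a p) * (pauliOp v * pauliOp (Pi.single a p)) =
      chi (sympl₁ p (v a)) • pauliOp v := by
    intro p
    rw [← mul_assoc, pauliOp_mul_comm, sympl_single, smul_mul_assoc, mul_assoc,
      pauliOp_mul_self, mul_one]
  simp only [this]
  rw [← Finset.sum_smul, sum_chi_sympl₁ h, zero_smul, smul_zero]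

/-- An operator is a linear combination of Pauli operators within its support. -/
lemma mem_span_pauliOp_of_supp_subset {O : Op Q} {M : Set Q} (h : supp O ⊆ M) :
    O ∈ Submodule.span ℂ (pauliOp '' {v : PauliLabel Q | ∀ a ∉ M, v a = 0}) := by
  classical
  have key : ∀ F : Finset Q, (∀ a ∈ F, a ∉ M) →
      O ∈ Submodule.span ℂ (pauliOp '' {v : PauliLabel Q | ∀ a ∈ F, v a = 0}) := by
    intro F
    induction F using Finset.induction_on with
    | empty =>
      intro _
      simp [span_pauliOp]
    | insert a F ha ih =>
      intro hF
      have h1 := ih fun b hb => hF b (Finset.mem_insert_of_mem hb)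
      -- Twirling at `a` fixes `O`, keeps the labels that vanish at `a` and kills all others, so one
      -- more site outside `M` is cleared.
      have h2 := Submodule.mem_map_of_mem (f := twirl a) h1
      rw [twirl_eq_self fun haO => hF a (Finset.mem_insert_self _ _) (h haO),
        Submodule.map_span] at h2
      refine Submodule.span_le.2 ?_ h2
      rintro _ ⟨_, ⟨v, hv, rfl⟩, rfl⟩
      by_cases hva : v a = 0
      · rw [twirl_eq_self (by simpa [mem_supp_pauliOp] using hva)]
        refine Submodule.subset_span ⟨v, fun b hb => ?_, rfl⟩
        rcases Finset.mem_insert.1 hb with rfl | hb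
        · exact hva
        · exact hv b hb
      · rw [twirl_pauliOp_eq_zero hva]
        exact Submodule.zero_mem _
  have := key (Finset.univ.filter fun a => a ∉ M) (by simp)
  simpa using this

lemma commute_of_disjoint_supp {A B : Op Q} (h : Disjoint (supp A) (supp B)) : Commute A B := by
  have hA := mem_span_pauliOp_of_supp_subset (subset_refl (supp A))
  have hB := mem_span_pauliOp_of_supp_subset (subset_refl (supp B))
  -- The sets are fixed first, so that the span inductions vary the operators but not the regions.
  generalize supp A = M at hA h
  generalize supp B = N at hB h
  induction hA using Submodule.span_induction with
  | zero => exact Commute.zero_left _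
  | add _ _ _ _ h1 h2 => exact h1.add_left h2
  | smul c _ _ h1 => exact h1.smul_left c
  | mem _ hv =>
    obtain ⟨v, hv, rfl⟩ := hv
    induction hB using Submodule.span_induction with
    | zero => exact Commute.zero_right _
    | add _ _ _ _ h1 h2 => exact h1.add_right h2
    | smul c _ _ h1 => exact h1.smul_right c
    | mem _ hw =>
      obtain ⟨w, hw, rfl⟩ := hw
      refine commute_pauliOp_iff.2 (sympl_eq_zero_of_disjoint fun a => ?_)
      by_cases ha : a ∈ M
      · exact Or.inr (hw a fun hb => Set.disjoint_left.1 h ha hb)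
      · exact Or.inl (hv a ha)

lemma exists_eq_smul_one_of_supp_empty {A : Op Q} (h : supp A ⊆ ∅) : ∃ c : ℂ, A = c • 1 := by
  have hA := mem_span_pauliOp_of_supp_subset h
  have : (pauliOp '' {v : PauliLabel Q | ∀ a ∉ (∅ : Set Q), v a = 0}) = {1} := by
    ext x
    constructor
    · rintro ⟨v, hv, rfl⟩
      have : v = 0 := funext fun a => hv a (by simp)
      simp [this, pauliOp_zero]
    · rintro rfl
      exact ⟨0, by simp, pauliOp_zero⟩
  rw [this, Submodule.mem_span_singleton] at hA
  obtain ⟨c, hc⟩ := hA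
  exact ⟨c, hc.symm⟩

/-! ### Locality-preserving operators on the lattice -/

section Lattice

variable {D L : ℕ}

/-- The set of sites at distance at most `s` from `M`. -/
def thicken (s : ℕ) (M : Set (Site D L)) : Set (Site D L) := {a | ∃ b ∈ M, siteDist a b ≤ s}

lemma siteDist_le_iff {a b : Site D L} {s : ℕ} :
    siteDist a b ≤ s ↔ ∀ i, ((a i : ℤ) - (b i : ℤ)).natAbs ≤ s := by
  simp [siteDist, Finset.sup_le_iff]

lemma siteDist_self (a : Site D L) : siteDist a a = 0 := by
  simp [siteDist]

lemma siteDist_triangle (a b c : Site D L) : siteDist a c ≤ siteDist a b + siteDist b c := by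
  rw [siteDist_le_iff]
  intro i
  have h1 := siteDist_le_iff.1 (le_refl (siteDist a b)) i
  have h2 := siteDist_le_iff.1 (le_refl (siteDist b c)) i
  omega

lemma siteDist_comm (a b : Site D L) : siteDist a b = siteDist b a := by
  simp only [siteDist]
  congr 1
  ext i
  omega

lemma subset_thicken (s : ℕ) (M : Set (Site D L)) : M ⊆ thicken s M :=
  fun a ha => ⟨a, ha, by simp [siteDist_self]⟩

lemma thicken_mono {s t : ℕ} {M N : Set (Site D L)} (hst : s ≤ t) (h : M ⊆ N) :
    thicken s M ⊆ thicken t N :=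
  fun _ ⟨b, hb, hab⟩ => ⟨b, h hb, hab.trans hst⟩

lemma thicken_thicken_subset (s t : ℕ) (M : Set (Site D L)) :
    thicken s (thicken t M) ⊆ thicken (s + t) M :=
  fun a ⟨b, ⟨c, hc, hbc⟩, hab⟩ =>
    ⟨c, hc, (siteDist_triangle a b c).trans (Nat.add_le_add hab hbc)⟩

/-- Conjugation by `K` or its adjoint enlarges supports by distance at most `s`. -/
def Spreads (s : ℕ) (K : Op (Site D L)) : Prop :=
  ∀ O, supp (K * O * Kᴴ) ⊆ thicken s (supp O) ∧ supp (Kᴴ * O * K) ⊆ thicken s (supp O)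

lemma Spreads.conjTranspose {s : ℕ} {K : Op (Site D L)} (h : Spreads s K) : Spreads s Kᴴ := by
  intro O
  rw [Matrix.conjTranspose_conjTranspose]
  exact (h O).symm

lemma Spreads.mul {s t : ℕ} {K K' : Op (Site D L)} (h : Spreads s K) (h' : Spreads t K') :
    Spreads (s + t) (K * K') := by
  intro O
  rw [Matrix.conjTranspose_mul]
  constructor
  · have e : K * K' * O * (K'ᴴ * Kᴴ) = K * (K' * O * K'ᴴ) * Kᴴ := by simp only [mul_assoc]
    rw [e]
    exact ((h _).1.trans (thicken_mono le_rfl (h' O).1)).trans (thicken_thicken_subset _ _ _)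
  · have e : K'ᴴ * Kᴴ * O * (K * K') = K'ᴴ * (Kᴴ * O * K) * K' := by simp only [mul_assoc]
    rw [e, add_comm]
    exact ((h' _).2.trans (thicken_mono le_rfl (h O).2)).trans (thicken_thicken_subset _ _ _)

lemma Spreads.one : Spreads 0 (1 : Op (Site D L)) := by
  intro O
  simp [subset_thicken]

/-- Moving a single-site Pauli operator past both copies of `pauliOp v` produces the same sign
twice, and the signs cancel. -/
lemma spreads_pauliOp (v : PauliLabel (Site D L)) : Spreads 0 (pauliOp v) := by
  intro O
  rw [pauliOp_conjTranspose, and_self]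
  refine Set.Subset.trans ?_ (subset_thicken 0 _)
  intro a ha
  by_contra h
  rw [notMem_supp_iff] at h
  refine notMem_supp_iff.2 (fun p => ?_) ha
  set P := pauliOp v
  set R := pauliOp (Pi.single a p : PauliLabel (Site D L))
  have hPR : P * R = chi (sympl v (Pi.single a p)) • (R * P) := pauliOp_mul_comm _ _
  set c := chi (sympl v (Pi.single a p))
  have hOR : O * R = R * O := (h p).eq
  calc P * O * P * R = P * O * (P * R) := by simp only [mul_assoc]
    _ = c • (P * (O * R) * P) := by rw [hPR, mul_smul_comm]; simp only [mul_assoc]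
    _ = c • (P * R * O * P) := by rw [hOR]; simp only [mul_assoc]
    _ = (c * c) • (R * P * O * P) := by rw [hPR]; simp only [smul_mul_assoc, smul_smul]
    _ = R * (P * O * P) := by rw [chi_mul_self, one_smul]; simp only [mul_assoc]

lemma mul_conjTranspose_of_mem {Q : Type} [Fintype Q] [DecidableEq Q] {U : Op Q}
    (h : U ∈ Matrix.unitaryGroup (Bits Q) ℂ) : U * Uᴴ = 1 :=
  Matrix.mem_unitaryGroup_iff.1 h

lemma conjTranspose_mul_of_mem {Q : Type} [Fintype Q] [DecidableEq Q] {U : Op Q}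
    (h : U ∈ Matrix.unitaryGroup (Bits Q) ℂ) : Uᴴ * U = 1 :=
  Matrix.mem_unitaryGroup_iff'.1 h

lemma conjTranspose_mem {Q : Type} [Fintype Q] [DecidableEq Q] {U : Op Q}
    (h : U ∈ Matrix.unitaryGroup (Bits Q) ℂ) : Uᴴ ∈ Matrix.unitaryGroup (Bits Q) ℂ := by
  rw [Matrix.mem_unitaryGroup_iff]
  change Uᴴ * Uᴴᴴ = 1
  rw [Matrix.conjTranspose_conjTranspose, conjTranspose_mul_of_mem h]

lemma IsLayer.conjTranspose {r : ℕ} {V : Op (Site D L)} (h : IsLayer r V) : IsLayer r Vᴴ := by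
  obtain ⟨gates, hg, hp, rfl⟩ := h
  refine ⟨(gates.map Matrix.conjTranspose).reverse, ?_, ?_, Matrix.conjTranspose_list_prod _⟩
  · intro g hgm
    simp only [List.mem_reverse, List.mem_map] at hgm
    obtain ⟨g, hgm, rfl⟩ := hgm
    exact ⟨conjTranspose_mem (hg g hgm).1, by rw [supp_conjTranspose]; exact (hg g hgm).2⟩
  · rw [List.pairwise_reverse, List.pairwise_map]
    refine hp.imp fun h => ?_
    rw [supp_conjTranspose, supp_conjTranspose]
    exact h.symm

/-- A gate that misses `supp O` also misses the gates already absorbed, by disjointness, so it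
cancels against its adjoint. Supports thus grow once per layer, whatever the number of gates. -/
lemma supp_conj_list_prod_subset {Q : Type} [Fintype Q] [DecidableEq Q] (gates : List (Op Q))
    (hu : ∀ g ∈ gates, g ∈ Matrix.unitaryGroup (Bits Q) ℂ)
    (hd : gates.Pairwise fun g g' => Disjoint (supp g) (supp g')) (O : Op Q) :
    supp (gates.prod * O * gates.prodᴴ) ⊆
      supp O ∪ {a | ∃ g ∈ gates, a ∈ supp g ∧ ∃ b ∈ supp g, b ∈ supp O} := by
  induction gates with
  | nil => simp
  | cons g gs ih =>
    rw [List.pairwise_cons] at hd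
    have ih := ih (fun g' hg' => hu g' (List.mem_cons_of_mem _ hg')) hd.2
    rw [List.prod_cons, Matrix.conjTranspose_mul]
    have e : g * gs.prod * O * (gs.prodᴴ * gᴴ) = g * (gs.prod * O * gs.prodᴴ) * gᴴ := by
      simp only [mul_assoc]
    rw [e]
    set O' := gs.prod * O * gs.prodᴴ
    have hO' : supp O' ⊆
        supp O ∪ {a | ∃ g' ∈ g :: gs, a ∈ supp g' ∧ ∃ b ∈ supp g', b ∈ supp O} := by
      refine ih.trans (Set.union_subset_union_right _ ?_)
      rintro a ⟨g', hg', h⟩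
      exact ⟨g', List.mem_cons_of_mem _ hg', h⟩
    by_cases hdis : ∃ b ∈ supp g, b ∈ supp O
    · refine (supp_mul_subset _ _).trans (Set.union_subset
        ((supp_mul_subset _ _).trans (Set.union_subset ?_ hO')) ?_)
      · exact fun a ha => Or.inr ⟨g, List.mem_cons_self, ha, hdis⟩
      · rw [supp_conjTranspose]
        exact fun a ha => Or.inr ⟨g, List.mem_cons_self, ha, hdis⟩
    · have hc : Commute g O' := by
        refine commute_of_disjoint_supp (Set.disjoint_left.2 fun a ha ha' => ?_)
        rcases ih ha' with h | ⟨g', hg', h, -⟩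
        · exact hdis ⟨a, ha, h⟩
        · exact Set.disjoint_left.1 (hd.1 g' hg') ha h
      rw [hc.eq, mul_assoc, mul_conjTranspose_of_mem (hu g List.mem_cons_self), mul_one]
      exact hO'

lemma IsLayer.supp_conj_subset {r : ℕ} {V : Op (Site D L)} (h : IsLayer r V)
    (O : Op (Site D L)) : supp (V * O * Vᴴ) ⊆ thicken r (supp O) := by
  obtain ⟨gates, hg, hp, rfl⟩ := h
  refine (supp_conj_list_prod_subset gates (fun g hgm => (hg g hgm).1) hp O).trans
    (Set.union_subset (subset_thicken _ _) ?_)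
  rintro a ⟨g, hgm, ha, b, hb, hbO⟩
  exact ⟨b, hbO, (hg g hgm).2 a ha b hb⟩

lemma IsLayer.spreads {r : ℕ} {V : Op (Site D L)} (h : IsLayer r V) : Spreads r V := by
  intro O
  refine ⟨h.supp_conj_subset O, ?_⟩
  have := h.conjTranspose.supp_conj_subset O
  rwa [Matrix.conjTranspose_conjTranspose] at this

lemma IsCircuit.spreads {h r : ℕ} {U : Op (Site D L)} (hU : IsCircuit h r U) :
    Spreads (h * r) U := by
  obtain ⟨layers, rfl, hl, rfl⟩ := hU
  induction layers with
  | nil => simpa using Spreads.one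
  | cons V l ih =>
    rw [List.prod_cons, List.length_cons, add_mul, one_mul, add_comm]
    exact (hl V List.mem_cons_self).spreads.mul
      (ih fun V' h' => hl V' (List.mem_cons_of_mem _ h'))

end Lattice

/-! ### Logical Pauli operators and correctable regions -/

lemma sympl_add_left (u v w : PauliLabel Q) : sympl (u + v) w = sympl u w + sympl v w := by
  simp only [sympl, ← Finset.sum_add_distrib]
  exact Finset.sum_congr rfl fun a _ => by simp [sympl₁]; ring

lemma sympl_smul_left (c : ZMod 2) (v w : PauliLabel Q) :
    sympl (c • v) w = c • sympl v w := by
  simp only [sympl, Finset.smul_sum]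
  exact Finset.sum_congr rfl fun a _ => by simp [sympl₁]; ring

variable (Q) in
/-- The symplectic form as a bilinear form over `ZMod 2`. -/
def symplForm : LinearMap.BilinForm (ZMod 2) (PauliLabel Q) :=
  LinearMap.mk₂ (ZMod 2) sympl sympl_add_left sympl_smul_left
    (fun u v w => by
      rw [sympl_comm, sympl_add_left, sympl_comm v, sympl_comm w])
    (fun c v w => by rw [sympl_comm, sympl_smul_left, sympl_comm w])

lemma symplForm_apply (v w : PauliLabel Q) : symplForm Q v w = sympl v w := rfl

lemma symplForm_isRefl : (symplForm Q).IsRefl := fun v w h => by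
  rw [symplForm_apply] at h ⊢
  rw [sympl_comm, h]

lemma symplForm_nondegenerate : (symplForm Q).Nondegenerate := by
  refine (LinearMap.IsRefl.nondegenerate_iff_separatingRight symplForm_isRefl).2 fun v hv => ?_
  ext1 a
  exact sympl₁_nondegenerate fun p => by
    rw [← sympl_single]; exact hv _

/-- A unit-norm multiple of a Pauli operator is unitary. -/
lemma pauliGroup_subset_unitaryGroup :
    pauliGroup Q ⊆ (Matrix.unitaryGroup (Bits Q) ℂ : Set (Op Q)) := by
  intro P hP
  obtain ⟨γ, v, hγ, rfl⟩ := mem_pauliGroup_iff.1 hP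
  refine Matrix.mem_unitaryGroup_iff.2 ?_
  change (γ • pauliOp v) * (γ • pauliOp v)ᴴ = 1
  rw [Matrix.conjTranspose_smul, pauliOp_conjTranspose, smul_mul_smul_comm, pauliOp_mul_self,
    Complex.star_def, Complex.mul_conj, Complex.normSq_eq_norm_sq, hγ]
  simp

lemma mul_mem_pauliGroup {P P' : Op Q} (h : P ∈ pauliGroup Q) (h' : P' ∈ pauliGroup Q) :
    P * P' ∈ pauliGroup Q := by
  obtain ⟨γ, v, hγ, rfl⟩ := mem_pauliGroup_iff.1 h
  obtain ⟨γ', v', hγ', rfl⟩ := mem_pauliGroup_iff.1 h'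
  obtain ⟨δ, hδ, e⟩ := pauliOp_mul v v'
  refine mem_pauliGroup_iff.2 ⟨γ * γ' * δ, v + v', by simp [hγ, hγ', hδ], ?_⟩
  rw [smul_mul_smul_comm, e, smul_smul]

lemma smul_mem_pauliGroup {c : ℂ} (hc : ‖c‖ = 1) {P : Op Q} (h : P ∈ pauliGroup Q) :
    c • P ∈ pauliGroup Q := by
  obtain ⟨γ, v, hγ, rfl⟩ := mem_pauliGroup_iff.1 h
  exact mem_pauliGroup_iff.2 ⟨c * γ, v, by simp [hγ, hc], by rw [smul_smul]⟩

lemma conjTranspose_mem_pauliGroup {P : Op Q} (h : P ∈ pauliGroup Q) : Pᴴ ∈ pauliGroup Q := by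
  obtain ⟨γ, v, hγ, rfl⟩ := mem_pauliGroup_iff.1 h
  exact mem_pauliGroup_iff.2 ⟨star γ, v, by simp [hγ], by
    rw [Matrix.conjTranspose_smul, pauliOp_conjTranspose]⟩

namespace StabilizerCode

variable (S : StabilizerCode Q)

/-- The labels of the stabilizers. -/
def labels : Submodule (ZMod 2) (PauliLabel Q) where
  carrier := {v | ∃ s ∈ S.group, ∃ γ : ℂ, ‖γ‖ = 1 ∧ (s : Op Q) = γ • pauliOp v}
  zero_mem' := ⟨1, S.group.one_mem, 1, by simp, by simp [pauliOp_zero]⟩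
  add_mem' := by
    rintro v w ⟨s, hs, γ, hγ, es⟩ ⟨t, ht, δ, hδ, et⟩
    obtain ⟨ε, hε, e⟩ := pauliOp_mul v w
    refine ⟨s * t, S.group.mul_mem hs ht, γ * δ * ε, by simp [hγ, hδ, hε], ?_⟩
    change (s : Op Q) * (t : Op Q) = _
    rw [es, et, smul_mul_smul_comm, e, smul_smul]
  smul_mem' := by
    rintro c v h
    rcases zmod_two_cases c with rfl | rfl
    · rw [zero_smul]
      exact ⟨1, S.group.one_mem, 1, by simp, by simp [pauliOp_zero]⟩
    · rwa [one_smul]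

/-- The Pauli operator labelled by `v` commutes with every stabilizer. -/
def Centralizes (v : PauliLabel Q) : Prop :=
  ∀ s ∈ S.group, Commute (s : Op Q) (pauliOp v)

variable {S}

lemma commute_smul_pauliOp_iff {γ : ℂ} (hγ : ‖γ‖ = 1) {u : PauliLabel Q} {A : Op Q} :
    Commute (γ • pauliOp u) A ↔ Commute (pauliOp u) A := by
  have h0 : γ ≠ 0 := by rintro rfl; simp at hγ
  refine ⟨fun h => ?_, fun h => h.smul_left γ⟩
  have := h.smul_left γ⁻¹
  rwa [smul_smul, inv_mul_cancel₀ h0, one_smul] at this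

lemma centralizes_iff {v : PauliLabel Q} :
    S.Centralizes v ↔ ∀ u ∈ S.labels, sympl u v = 0 := by
  constructor
  · rintro h u ⟨s, hs, γ, hγ, e⟩
    have := h s hs
    rwa [e, commute_smul_pauliOp_iff hγ, commute_pauliOp_iff] at this
  · intro h s hs
    obtain ⟨γ, u, hγ, e⟩ := mem_pauliGroup_iff.1 (S.isPauli s hs)
    rw [e, commute_smul_pauliOp_iff hγ, commute_pauliOp_iff]
    exact h u ⟨s, hs, γ, hγ, e⟩

lemma Centralizes.add {v w : PauliLabel Q} (hv : S.Centralizes v) (hw : S.Centralizes w) :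
    S.Centralizes (v + w) := by
  rw [centralizes_iff] at *
  intro u hu
  rw [sympl_comm, sympl_add_left, sympl_comm, hv u hu, sympl_comm, hw u hu, add_zero]

lemma labels_centralizes {v : PauliLabel Q} (hv : v ∈ S.labels) : S.Centralizes v := by
  obtain ⟨s, hs, γ, hγ, e⟩ := hv
  intro t ht
  have h : Commute (s : Op Q) (t : Op Q) := congrArg Subtype.val (S.commute s hs t ht)
  rw [e, commute_smul_pauliOp_iff hγ] at h
  exact h.symm

lemma Centralizes.mulVec_mem {v : PauliLabel Q} (hv : S.Centralizes v) {ψ : Bits Q → ℂ}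
    (hψ : ψ ∈ S.codespace) : pauliOp v *ᵥ ψ ∈ S.codespace := by
  intro s hs
  rw [Matrix.mulVec_mulVec, (hv s hs).eq, ← Matrix.mulVec_mulVec, hψ s hs]

lemma Centralizes.isLogical {v : PauliLabel Q} (hv : S.Centralizes v) :
    S.IsLogical (pauliOp v) := by
  refine ⟨pauliGroup_subset_unitaryGroup (pauliOp_mem v), ?_⟩
  ext ψ
  rw [Submodule.mem_map]
  constructor
  · rintro ⟨φ, hφ, rfl⟩
    exact hv.mulVec_mem hφ
  · intro hψ
    refine ⟨pauliOp v *ᵥ ψ, hv.mulVec_mem hψ, ?_⟩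
    rw [Matrix.mulVecLin_apply, Matrix.mulVec_mulVec, pauliOp_mul_self, Matrix.one_mulVec]

/-- A stabilizer anticommuting with `pauliOp v` would send the nonzero code vector `pauliOp v *ᵥ ψ`
to its negative instead of fixing it. -/
lemma centralizes_of_mulVec_mem {v : PauliLabel Q} (hS : ∃ ψ ∈ S.codespace, ψ ≠ 0)
    (h : ∀ ψ ∈ S.codespace, pauliOp v *ᵥ ψ ∈ S.codespace) : S.Centralizes v := by
  obtain ⟨ψ, hψ, hψ0⟩ := hS
  rw [centralizes_iff]
  rintro u ⟨s, hs, γ, hγ, e⟩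
  have h1 := h ψ hψ s hs
  rw [Matrix.mulVec_mulVec, e, smul_mul_assoc, pauliOp_mul_comm, smul_comm, ← mul_smul_comm,
    ← e, Matrix.smul_mulVec, ← Matrix.mulVec_mulVec, hψ s hs] at h1
  have hne : pauliOp v *ᵥ ψ ≠ 0 := by
    intro h0
    have : pauliOp v *ᵥ (pauliOp v *ᵥ ψ) = 0 := by rw [h0, Matrix.mulVec_zero]
    rw [Matrix.mulVec_mulVec, pauliOp_mul_self, Matrix.one_mulVec] at this
    exact hψ0 this
  rw [← chi_eq_one_iff]
  have h2 : (chi (sympl u v) - 1) • (pauliOp v *ᵥ ψ) = 0 := by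
    rw [sub_smul, h1, one_smul, sub_self]
  exact sub_eq_zero.1 ((smul_eq_zero.1 h2).resolve_right hne)

variable (S) in
/-- The Pauli operator labelled by `v` acts on the codespace as a scalar. -/
def ActsAsScalar (v : PauliLabel Q) : Prop :=
  ∃ c : ℂ, ∀ ψ ∈ S.codespace, pauliOp v *ᵥ ψ = c • ψ

variable (S) in
/-- A region is correctable if every logical Pauli operator on it acts as a scalar. -/
def Correctable (M : Set Q) : Prop :=
  ∀ v, S.Centralizes v → (∀ a ∉ M, v a = 0) → S.ActsAsScalar v

lemma ActsAsScalar.zero : S.ActsAsScalar 0 := ⟨1, fun ψ _ => by simp [pauliOp_zero]⟩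

lemma ActsAsScalar.add {v w : PauliLabel Q} (hv : S.ActsAsScalar v) (hw : S.ActsAsScalar w) :
    S.ActsAsScalar (v + w) := by
  obtain ⟨c, hc⟩ := hv
  obtain ⟨d, hd⟩ := hw
  obtain ⟨γ, hγ, e⟩ := pauliOp_mul v w
  have h0 : γ ≠ 0 := by rintro rfl; simp at hγ
  refine ⟨γ⁻¹ * (d * c), fun ψ hψ => ?_⟩
  have e' : pauliOp (v + w) = γ⁻¹ • (pauliOp v * pauliOp w) := by
    rw [e, smul_smul, inv_mul_cancel₀ h0, one_smul]
  rw [e', Matrix.smul_mulVec, ← Matrix.mulVec_mulVec, hd ψ hψ, Matrix.mulVec_smul, hc ψ hψ,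
    smul_smul, smul_smul, mul_assoc]

/-- On the codespace a scalar commutes with every logical operator, so the sign in the commutation
relation must be 1 as soon as the codespace is nonzero. -/
lemma sympl_eq_zero_of_actsAsScalar (hS : ∃ ψ ∈ S.codespace, ψ ≠ 0) {v q : PauliLabel Q}
    (hv : S.Centralizes v) (hq : S.ActsAsScalar q) : sympl q v = 0 := by
  obtain ⟨ψ, hψ, hψ0⟩ := hS
  obtain ⟨c, hc⟩ := hq
  have inv : ∀ (u : PauliLabel Q) (φ : Bits Q → ℂ), pauliOp u *ᵥ (pauliOp u *ᵥ φ) = φ := by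
    intro u φ
    rw [Matrix.mulVec_mulVec, pauliOp_mul_self, Matrix.one_mulVec]
  have h0 : pauliOp q *ᵥ (pauliOp v *ᵥ ψ) ≠ 0 := by
    intro h
    have h1 := inv q (pauliOp v *ᵥ ψ)
    rw [h, Matrix.mulVec_zero] at h1
    have h2 := inv v ψ
    rw [← h1, Matrix.mulVec_zero] at h2
    exact hψ0 h2.symm
  have h1 : pauliOp q *ᵥ (pauliOp v *ᵥ ψ) = pauliOp v *ᵥ (pauliOp q *ᵥ ψ) := by
    rw [hc _ (hv.mulVec_mem hψ), hc _ hψ, Matrix.mulVec_smul]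
  have h2 : pauliOp q *ᵥ (pauliOp v *ᵥ ψ) =
      chi (sympl q v) • (pauliOp v *ᵥ (pauliOp q *ᵥ ψ)) := by
    rw [Matrix.mulVec_mulVec, pauliOp_mul_comm, Matrix.smul_mulVec, Matrix.mulVec_mulVec]
  rw [← h1] at h2
  have h3 : (1 - chi (sympl q v)) • (pauliOp q *ᵥ (pauliOp v *ᵥ ψ)) = 0 := by
    rw [sub_smul, ← h2, one_smul, sub_self]
  exact (chi_eq_one_iff _).1 (sub_eq_zero.1 ((smul_eq_zero.1 h3).resolve_right h0)).symm

/-- The labels of Pauli operators supported outside `M`. -/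
def labelsOff (M : Set Q) : Submodule (ZMod 2) (PauliLabel Q) where
  carrier := {v | ∀ a ∈ M, v a = 0}
  zero_mem' := fun _ _ => rfl
  add_mem' := fun hv hw a ha => by rw [Pi.add_apply, hv a ha, hw a ha, add_zero]
  smul_mem' := fun c v hv a ha => by rw [Pi.smul_apply, hv a ha, smul_zero]

/-- The cleaning lemma: a logical Pauli operator can be multiplied by a stabilizer such that the
product acts trivially on a given correctable region. -/
lemma Correctable.exists_clean {M : Set Q} (hM : S.Correctable M)
    (hS : ∃ ψ ∈ S.codespace, ψ ≠ 0) {v : PauliLabel Q} (hv : S.Centralizes v) :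
    ∃ w, S.Centralizes w ∧ (∀ a ∈ M, w a = 0) ∧
      ∃ γ : ℂ, ‖γ‖ = 1 ∧ ∀ ψ ∈ S.codespace, pauliOp v *ᵥ ψ = γ • (pauliOp w *ᵥ ψ) := by
  -- By the double orthogonal complement, it suffices that `v` is orthogonal to every `q` orthogonal
  -- to both summands. Such a `q` labels a logical operator supported on `M`, hence a scalar.
  have hmem : v ∈ S.labels ⊔ labelsOff M := by
    rw [← LinearMap.BilinForm.orthogonal_orthogonal symplForm_nondegenerate symplForm_isRefl
      (S.labels ⊔ labelsOff M), LinearMap.BilinForm.mem_orthogonal_iff]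
    intro q hq
    rw [LinearMap.BilinForm.mem_orthogonal_iff] at hq
    refine sympl_eq_zero_of_actsAsScalar hS hv (hM q (centralizes_iff.2 fun u hu =>
      hq u (Submodule.mem_sup_left hu)) fun a ha => sympl₁_nondegenerate fun p => ?_)
    rw [← sympl_single]
    refine hq _ (Submodule.mem_sup_right fun b hb => ?_)
    rw [Pi.single_eq_of_ne]
    rintro rfl
    exact ha hb
  obtain ⟨u, hu, w, hw, rfl⟩ := Submodule.mem_sup.1 hmem
  -- Labels have characteristic two, so `w` is recovered from `u + w` by adding `u` again.
  have hcw : S.Centralizes w := by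
    have := hv.add (labels_centralizes hu)
    have e : u + w + u = w := by
      have h2 : u + u = 0 := by
        ext1 a
        exact Prod.ext (CharTwo.add_self_eq_zero _) (CharTwo.add_self_eq_zero _)
      rw [add_comm u w, add_assoc, h2, add_zero]
    rwa [e] at this
  obtain ⟨s, hs, γ, hγ, e⟩ := hu
  obtain ⟨δ, hδ, e'⟩ := pauliOp_mul w u
  have hγ0 : γ ≠ 0 := by rintro rfl; simp at hγ
  have hδ0 : δ ≠ 0 := by rintro rfl; simp at hδ
  refine ⟨w, hcw, hw, δ⁻¹ * γ⁻¹, by simp [hγ, hδ], fun ψ hψ => ?_⟩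
  have e1 : pauliOp (u + w) = (δ⁻¹ * γ⁻¹) • (pauliOp w * (s : Op Q)) := by
    rw [e, mul_smul_comm, e', smul_smul, smul_smul, add_comm w u]
    have : δ⁻¹ * γ⁻¹ * γ * δ = 1 := by field_simp
    rw [this, one_smul]
  rw [e1, Matrix.smul_mulVec, ← Matrix.mulVec_mulVec, hψ s hs]

end StabilizerCode

/-! ### Encodings -/

section Encoding

variable {S S₁ S₂ S₃ : StabilizerCode Q}

lemma IsMorphism.mulVec_mem {U : Op Q} (h : IsMorphism S₁ S₂ U) {ψ : Bits Q → ℂ}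
    (hψ : ψ ∈ S₁.codespace) : U *ᵥ ψ ∈ S₂.codespace := by
  rw [← h.2]
  exact ⟨ψ, hψ, rfl⟩

lemma IsMorphism.conjTranspose {U : Op Q} (h : IsMorphism S₁ S₂ U) : IsMorphism S₂ S₁ Uᴴ := by
  refine ⟨conjTranspose_mem h.1, ?_⟩
  rw [← h.2, ← Submodule.map_comp, ← Matrix.mulVecLin_mul, conjTranspose_mul_of_mem h.1,
    Matrix.mulVecLin_one, Submodule.map_id]

lemma IsMorphism.mul {U V : Op Q} (hV : IsMorphism S₂ S₃ V) (hU : IsMorphism S₁ S₂ U) :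
    IsMorphism S₁ S₃ (V * U) := by
  refine ⟨mul_mem hV.1 hU.1, ?_⟩
  rw [Matrix.mulVecLin_mul, Submodule.map_comp, hU.2, hV.2]

variable {k : ℕ} {J J₁ J₂ J₃ : Matrix (Bits Q) (Bits (Fin k)) ℂ}

namespace StabilizerCode.IsEncoding

lemma mulVec_mem (hJ : S.IsEncoding J) (x : Bits (Fin k) → ℂ) : J *ᵥ x ∈ S.codespace := by
  rw [← hJ.2.1]
  exact ⟨x, rfl⟩

lemma exists_ne_zero (hJ : S.IsEncoding J) : ∃ ψ ∈ S.codespace, ψ ≠ 0 := by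
  refine ⟨J *ᵥ Pi.single 0 1, hJ.mulVec_mem _, fun h => ?_⟩
  have h1 : Jᴴ *ᵥ (J *ᵥ Pi.single (0 : Bits (Fin k)) (1 : ℂ)) = 0 := by
    rw [h, Matrix.mulVec_zero]
  rw [Matrix.mulVec_mulVec, hJ.1, Matrix.one_mulVec] at h1
  have := congrFun h1 0
  simp at this

lemma mul_eq_mul (hJ : S.IsEncoding J) {A B : Op Q}
    (h : ∀ ψ ∈ S.codespace, A *ᵥ ψ = B *ᵥ ψ) : A * J = B * J := by
  refine Matrix.ext_of_mulVec_single fun x => ?_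
  rw [← Matrix.mulVec_mulVec, ← Matrix.mulVec_mulVec, h _ (hJ.mulVec_mem _)]

lemma mul_conjTranspose_mulVec (hJ : S.IsEncoding J) {ψ : Bits Q → ℂ} (hψ : ψ ∈ S.codespace) :
    (J * Jᴴ) *ᵥ ψ = ψ := by
  rw [← hJ.2.1] at hψ
  obtain ⟨x, rfl⟩ := hψ
  rw [Matrix.mulVecLin_apply, Matrix.mulVec_mulVec, Matrix.mul_assoc, hJ.1, Matrix.mul_one]

lemma morphism_mul (h₁ : S₁.IsEncoding J₁) (h₂ : S₂.IsEncoding J₂) {U : Op Q}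
    (hU : IsMorphism S₁ S₂ U) : J₂ * (J₂ᴴ * U * J₁) = U * J₁ := by
  have := h₁.mul_eq_mul (A := J₂ * J₂ᴴ * U) (B := U) fun ψ hψ => by
    rw [← Matrix.mulVec_mulVec, h₂.mul_conjTranspose_mulVec (hU.mulVec_mem hψ)]
  simpa only [Matrix.mul_assoc] using this

/-- Since `J₂ * J₂ᴴ` is the identity on the codespace that contains the image of `U * J₁`, passing
to encoded operators is multiplicative along morphisms. -/
lemma mul_comp (h₁ : S₁.IsEncoding J₁) (h₂ : S₂.IsEncoding J₂) {U V : Op Q}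
    (hU : IsMorphism S₁ S₂ U) :
    J₃ᴴ * (V * U) * J₁ = (J₃ᴴ * V * J₂) * (J₂ᴴ * U * J₁) := by
  rw [Matrix.mul_assoc (J₃ᴴ * V), h₁.morphism_mul h₂ hU]
  simp only [Matrix.mul_assoc]

lemma conjTranspose_comp (U : Op Q) : (J₂ᴴ * U * J₁)ᴴ = J₁ᴴ * Uᴴ * J₂ := by
  simp only [Matrix.conjTranspose_mul, Matrix.conjTranspose_conjTranspose, Matrix.mul_assoc]

lemma comp_mem_unitaryGroup (h₁ : S₁.IsEncoding J₁) (h₂ : S₂.IsEncoding J₂) {U : Op Q}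
    (hU : IsMorphism S₁ S₂ U) :
    J₂ᴴ * U * J₁ ∈ Matrix.unitaryGroup (Bits (Fin k)) ℂ := by
  rw [Matrix.mem_unitaryGroup_iff]
  change J₂ᴴ * U * J₁ * (J₂ᴴ * U * J₁)ᴴ = 1
  rw [conjTranspose_comp, ← h₂.mul_comp h₁ hU.conjTranspose, mul_conjTranspose_of_mem hU.1,
    Matrix.mul_one, h₂.1]

/-- Every encoded Pauli operator has a logical representative that acts trivially on a given
correctable region. -/
lemma exists_clean (hJ : S.IsEncoding J) {M : Set Q} (hM : S.Correctable M) {P : Op (Fin k)}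
    (hP : P ∈ pauliGroup (Fin k)) :
    ∃ w, S.Centralizes w ∧ (∀ a ∈ M, w a = 0) ∧ ∃ γ : ℂ, ‖γ‖ = 1 ∧
      P = γ • (Jᴴ * pauliOp w * J) := by
  have hP' := hP
  rw [hJ.2.2] at hP'
  obtain ⟨P', hP', hlog, rfl⟩ := hP'
  obtain ⟨δ, v, hδ, rfl⟩ := mem_pauliGroup_iff.1 hP'
  have hδ0 : δ ≠ 0 := by rintro rfl; simp at hδ
  have hv : S.Centralizes v := by
    refine StabilizerCode.centralizes_of_mulVec_mem hJ.exists_ne_zero fun ψ hψ => ?_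
    have h1 := Submodule.smul_mem _ δ⁻¹ (hlog.mulVec_mem hψ)
    rwa [Matrix.smul_mulVec, smul_smul, inv_mul_cancel₀ hδ0, one_smul] at h1
  obtain ⟨w, hw, hwM, γ, hγ, e⟩ := hM.exists_clean hJ.exists_ne_zero hv
  refine ⟨w, hw, hwM, δ * γ, by simp [hδ, hγ], ?_⟩
  have e1 : pauliOp v * J = (γ • pauliOp w) * J := hJ.mul_eq_mul fun ψ hψ => by
    rw [e ψ hψ, Matrix.smul_mulVec]
  rw [Matrix.mul_smul, Matrix.smul_mul, Matrix.mul_assoc, e1]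
  simp only [Matrix.smul_mul, Matrix.mul_smul, smul_smul, Matrix.mul_assoc]

/-- An operator supported on a correctable region is encoded as a scalar. -/
lemma exists_eq_smul_one (hJ : S.IsEncoding J) {M : Set Q} (hM : S.Correctable M) {K : Op Q}
    (hK : supp K ⊆ M) : ∃ c : ℂ, Jᴴ * K * J = c • 1 := by
  have h := mem_span_pauliOp_of_supp_subset hK
  clear hK
  induction h using Submodule.span_induction with
  | zero => exact ⟨0, by simp⟩
  | add A B _ _ hA hB =>
    obtain ⟨c, hc⟩ := hA
    obtain ⟨d, hd⟩ := hB
    exact ⟨c + d, by rw [Matrix.mul_add, Matrix.add_mul, hc, hd, add_smul]⟩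
  | smul b A _ hA =>
    obtain ⟨c, hc⟩ := hA
    exact ⟨b * c, by rw [Matrix.mul_smul, Matrix.smul_mul, hc, smul_smul]⟩
  | mem _ hv =>
    obtain ⟨v, hvM, rfl⟩ := hv
    by_cases hv : S.Centralizes v
    · obtain ⟨c, hc⟩ := hM v hv hvM
      refine ⟨c, ?_⟩
      have e1 : pauliOp v * J = (c • 1 : Op Q) * J := hJ.mul_eq_mul fun ψ hψ => by
        rw [hc ψ hψ, Matrix.smul_mulVec, Matrix.one_mulVec]
      rw [Matrix.mul_assoc, e1, Matrix.smul_mul, Matrix.one_mul, Matrix.mul_smul, hJ.1]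
    -- Here some stabilizer `s` anticommutes with `pauliOp v`. Absorbing `s` into `J` on the right
    -- and into `Jᴴ` on the left shows that the compression equals its own negative.
    · refine ⟨0, ?_⟩
      rw [StabilizerCode.centralizes_iff] at hv
      push Not at hv
      obtain ⟨u, ⟨s, hs, γ, hγ, e⟩, huv⟩ := hv
      have huv : sympl v u = 1 := by
        rw [sympl_comm]; exact (zmod_two_cases _).resolve_left huv
      have e1 : (s : Op Q) * J = J := by
        have := hJ.mul_eq_mul (A := (s : Op Q)) (B := 1) fun ψ hψ => by
          rw [hψ s hs, Matrix.one_mulVec]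
        rwa [Matrix.one_mul] at this
      have e2 : Jᴴ * (s : Op Q) = Jᴴ := by
        have h1 : (s : Op Q)ᴴ * J = J := by
          conv_lhs => rw [← e1, ← Matrix.mul_assoc, conjTranspose_mul_of_mem s.2, Matrix.one_mul]
        have h2 := congrArg Matrix.conjTranspose h1
        rwa [Matrix.conjTranspose_mul, Matrix.conjTranspose_conjTranspose] at h2
      have e3 : pauliOp v * (s : Op Q) = -((s : Op Q) * pauliOp v) := by
        rw [e, mul_smul_comm, pauliOp_mul_comm, huv, chi_one, neg_one_smul, smul_neg,
          smul_mul_assoc]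
      have e4 : Jᴴ * pauliOp v * J = -(Jᴴ * pauliOp v * J) := by
        calc Jᴴ * pauliOp v * J = Jᴴ * (pauliOp v * (s : Op Q)) * J := by
              simp only [Matrix.mul_assoc, e1]
          _ = -(Jᴴ * (s : Op Q) * pauliOp v * J) := by
              rw [e3, Matrix.mul_neg, Matrix.neg_mul, ← Matrix.mul_assoc]
          _ = -(Jᴴ * pauliOp v * J) := by rw [e2]
      rw [zero_smul]
      have h2 : (2 : ℂ) • (Jᴴ * pauliOp v * J) = 0 := by
        rw [two_smul]; nth_rewrite 1 [e4]; exact neg_add_cancel _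
      exact (smul_eq_zero.1 h2).resolve_left two_ne_zero

end StabilizerCode.IsEncoding

end Encoding

/-! ### The Clifford hierarchy -/

/-- Conjugation by `P` preserves the Pauli group, so `A * P` conjugates Pauli operators into the
same level as `A`. This recovers `K P Kᴴ` from the commutator `K P Kᴴ P`. -/
lemma mul_mem_cliffordLevel (n : ℕ) {A P : Op Q} (hA : A ∈ cliffordLevel Q (n + 1))
    (hP : P ∈ pauliGroup Q) : A * P ∈ cliffordLevel Q (n + 1) := by
  cases n with
  | zero => exact mul_mem_pauliGroup hA hP
  | succ n =>
    refine ⟨mul_mem hA.1 (pauliGroup_subset_unitaryGroup hP), fun R hR => ?_⟩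
    rw [Matrix.conjTranspose_mul]
    have e : A * P * R * (Pᴴ * Aᴴ) = A * (P * R * Pᴴ) * Aᴴ := by simp only [mul_assoc]
    rw [e]
    exact hA.2 _ (mul_mem_pauliGroup (mul_mem_pauliGroup hP hR) (conjTranspose_mem_pauliGroup hP))

/-- A unitary that commutes with every Pauli operator up to a scalar is a Pauli operator. -/
lemma mem_pauliGroup_of_mul_eq_smul {K : Op Q} (hK : K ∈ Matrix.unitaryGroup (Bits Q) ℂ)
    (h : ∀ w, ∃ c : ℂ, K * pauliOp w = c • (pauliOp w * K)) : K ∈ pauliGroup Q := by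
  -- Pauli operators span and tr(`Kᴴ * K`) is nonzero, so `K` overlaps with one of them.
  obtain ⟨v, hv⟩ : ∃ v, (pauliOp v * K).trace ≠ 0 := by
    by_contra hcon
    push Not at hcon
    have htr : (Kᴴ * K).trace ≠ 0 := by
      rw [conjTranspose_mul_of_mem hK, Matrix.trace_one]
      exact Nat.cast_ne_zero.2 Fintype.card_ne_zero
    apply htr
    have h1 : Kᴴ ∈ Submodule.span ℂ (Set.range (pauliOp (Q := Q))) := by simp [span_pauliOp]
    generalize Kᴴ = A at h1
    induction h1 using Submodule.span_induction with
    | zero => simp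
    | add A B _ _ hA hB => rw [add_mul, Matrix.trace_add, hA, hB, add_zero]
    | smul c A _ hA => rw [smul_mul_assoc, Matrix.trace_smul, hA, smul_zero]
    | mem _ hx =>
      obtain ⟨v, rfl⟩ := hx
      exact hcon v
  set T := pauliOp v * K with hT
  -- `T` commutes with each `pauliOp w` up to a factor; conjugation preserves the nonzero trace of
  -- `T`, so the factor is 1.
  have hcomm : ∀ w, Commute T (pauliOp w) := by
    intro w
    obtain ⟨c, hc⟩ := h w
    have h1 : T * pauliOp w = (c * chi (sympl v w)) • (pauliOp w * T) := by
      rw [hT, mul_assoc, hc, mul_smul_comm, ← mul_assoc, pauliOp_mul_comm, smul_mul_assoc,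
        smul_smul, mul_assoc]
    have h2 : (pauliOp w * (T * pauliOp w)).trace = T.trace := by
      rw [Matrix.trace_mul_comm, mul_assoc, pauliOp_mul_self, mul_one]
    rw [h1, mul_smul_comm, ← mul_assoc, pauliOp_mul_self, one_mul, Matrix.trace_smul,
      smul_eq_mul] at h2
    have h3 : c * chi (sympl v w) = 1 := mul_right_cancel₀ hv (by rw [h2, one_mul])
    rw [h3, one_smul] at h1
    exact h1
  obtain ⟨c, hc⟩ := exists_eq_smul_one_of_supp_empty (A := T) fun a ha =>
    absurd ha (notMem_supp_iff.2 fun p => hcomm _)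
  have hKc : K = c • pauliOp v := by
    have : pauliOp v * T = K := by rw [hT, ← mul_assoc, pauliOp_mul_self, one_mul]
    rw [← this, hc, mul_smul_comm, mul_one]
  refine mem_pauliGroup_iff.2 ⟨c, v, ?_, hKc⟩
  have h1 := mul_conjTranspose_of_mem hK
  rw [hKc, Matrix.conjTranspose_smul, pauliOp_conjTranspose, smul_mul_smul_comm,
    pauliOp_mul_self, Complex.star_def, Complex.mul_conj, Complex.normSq_eq_norm_sq] at h1
  have h2 := congrFun (congrFun h1 0) 0
  simp only [Matrix.smul_apply, Matrix.one_apply_eq, smul_eq_mul, mul_one] at h2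
  have h3 : ‖c‖ ^ 2 = 1 := by exact_mod_cast h2
  exact (pow_eq_one_iff_of_nonneg (norm_nonneg c) two_ne_zero).1 h3

/-! ### Correctability of unions of well separated small regions -/

variable {D L : ℕ}

lemma correctable_of_ncard_lt {Q : Type} [Fintype Q] [DecidableEq Q] {S : StabilizerCode Q}
    {d : ℕ} (hd : S.HasDistance d) {M : Set Q} (hM : M.ncard < d) : S.Correctable M := by
  intro v hv hvM
  refine hd _ (pauliOp_mem v) hv.isLogical ((Set.ncard_le_ncard ?_ M.toFinite).trans_lt hM)
  intro a ha
  by_contra h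
  exact mem_supp_pauliOp.1 ha (hvM a h)

/-- A region is correctable if it is a union of small pieces, labelled by `τ`, such that no local
generator of the stabilizer group meets two of them. -/
lemma correctable_of_fibers {S : StabilizerCode (Site D L)} {ξ d : ℕ}
    (hloc : HasLocalGenerators S ξ) (hd : S.HasDistance d) {M : Set (Site D L)}
    {ι : Type*} (τ : Site D L → ι)
    (hτ : ∀ a ∈ M, ∀ b ∈ M, siteDist a b ≤ ξ → τ a = τ b)
    (hcard : ∀ i, {a ∈ M | τ a = i}.ncard < d) : S.Correctable M := by
  classical
  intro v hv hvM
  set f : ι → PauliLabel (Site D L) := fun i a => if τ a = i then v a else 0 with hf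
  have hsum : v = ∑ i ∈ Finset.univ.image τ, f i := by
    ext1 a
    rw [Finset.sum_apply, Finset.sum_ite_eq, if_pos (Finset.mem_image_of_mem τ (Finset.mem_univ a))]
  rw [hsum]
  refine Finset.sum_induction f S.ActsAsScalar (fun _ _ => StabilizerCode.ActsAsScalar.add)
    StabilizerCode.ActsAsScalar.zero fun i _ => ?_
  refine correctable_of_ncard_lt hd (hcard i) (f i) ?_ fun a ha => ?_
  · obtain ⟨G, hG, hdiam⟩ := hloc
    intro s hs
    rw [← hG] at hs
    induction hs using Subgroup.closure_induction with
    | one => exact Commute.one_left _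
    | mul x y _ _ hx hy => exact hx.mul_left hy
    | inv x _ hx =>
      have h1 : (x : Op (Site D L))ᴴ * (x : Op (Site D L)) = 1 := conjTranspose_mul_of_mem x.2
      have h2 : (x : Op (Site D L)) * (x : Op (Site D L))ᴴ = 1 := mul_conjTranspose_of_mem x.2
      change (x : Op (Site D L))ᴴ * _ = _ * (x : Op (Site D L))ᴴ
      calc (x : Op (Site D L))ᴴ * pauliOp (f i)
          = (x : Op (Site D L))ᴴ * (pauliOp (f i) * (x : Op (Site D L))) *
              (x : Op (Site D L))ᴴ := by simp only [mul_assoc, h2, mul_one]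
        _ = _ := by rw [← hx.eq, ← mul_assoc, h1, one_mul]
    | mem g hg =>
      have hgS : g ∈ S.group := hG ▸ Subgroup.subset_closure hg
      have hc := hv g hgS
      have hdg := hdiam g hg
      obtain ⟨γ, u, hγ, e⟩ := mem_pauliGroup_iff.1 (S.isPauli g hgS)
      have hsupp : ∀ a, u a ≠ 0 → a ∈ supp (g : Op (Site D L)) := by
        intro a ha
        rw [← mem_supp_pauliOp] at ha
        have h0 : γ ≠ 0 := by rintro rfl; simp at hγ
        have e' : pauliOp u = γ⁻¹ • (g : Op (Site D L)) := by
          rw [e, smul_smul, inv_mul_cancel₀ h0, one_smul]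
        rw [e'] at ha
        exact supp_smul_subset _ _ ha
      rw [e, StabilizerCode.commute_smul_pauliOp_iff hγ, commute_pauliOp_iff] at hc ⊢
      -- A generator meeting fibre `i` meets no other fibre, so it sees `f i` exactly as it sees
      -- `v`; any other generator does not see `f i` at all.
      by_cases hmeet : ∃ a ∈ M, τ a = i ∧ u a ≠ 0
      · obtain ⟨a, haM, hai, hau⟩ := hmeet
        rw [← hc]
        refine Finset.sum_congr rfl fun b _ => ?_
        by_cases hbu : u b = 0
        · simp [hbu, sympl₁]
        by_cases hbM : b ∈ M
        · have := hτ a haM b hbM (hdg a (hsupp a hau) b (hsupp b hbu))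
          rw [hf]
          simp [← this, hai]
        · simp [hf, hvM b hbM]
      · push Not at hmeet
        refine sympl_eq_zero_of_disjoint fun a => ?_
        by_cases hai : τ a = i
        · by_cases haM : a ∈ M
          · exact Or.inl (hmeet a haM hai)
          · exact Or.inr (by simp [hf, hvM a haM])
        · exact Or.inr (by simp [hf, hai])
  · by_cases hai : τ a = i
    · have : a ∉ M := fun h => ha ⟨h, hai⟩
      simp [hf, hvM a this]
    · simp [hf, hai]

/-! ### A cover of the lattice by `D + 1` regions consisting of separated boxes -/

/-- The region of colour `c`: a union of boxes of side `D * w` separated by gaps of width `w`. -/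
def colorRegion (D L w c : ℕ) : Set (Site D L) := {a | ∀ i, ((a i : ℕ) / w + c) % (D + 1) ≠ 0}

/-- Each of the `D` coordinates forbids exactly one of the `D + 1` colours, namely minus its block
index modulo `D + 1`, so some colour is left. -/
lemma exists_mem_colorRegion (w : ℕ) (a : Site D L) : ∃ c ≤ D, a ∈ colorRegion D L w c := by
  have hns : ¬ Function.Surjective fun i : Fin D =>
      (⟨(D - (a i : ℕ) / w % (D + 1) + 1) % (D + 1), Nat.mod_lt _ D.succ_pos⟩ : Fin (D + 1)) := by
    intro h
    have := Fintype.card_le_of_surjective _ h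
    simp at this
  simp only [Function.Surjective, not_forall, not_exists] at hns
  obtain ⟨c, hc⟩ := hns
  refine ⟨c, Nat.lt_succ_iff.1 c.2, fun i hi => hc i (Fin.ext ?_)⟩
  simp only
  have hr := Nat.mod_lt ((a i : ℕ) / w) D.succ_pos
  rw [Nat.add_mod, Nat.mod_eq_of_lt c.2] at hi
  set r := (a i : ℕ) / w % (D + 1)
  have hdvd := Nat.dvd_of_mod_eq_zero hi
  have hc2 := c.2
  obtain ⟨q, hq⟩ := hdvd
  have hq2 : q < 2 := by
    by_contra hcon
    have : (D + 1) * 2 ≤ (D + 1) * q := Nat.mul_le_mul_left _ (by omega)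
    omega
  interval_cases q
  · have hr0 : r = 0 := by omega
    have hc0 : (c : ℕ) = 0 := by omega
    simp [hr0, hc0]
  · rw [Nat.mod_eq_of_lt] <;> omega

lemma le_mod_of_div_add_mod_ne_zero {w x c m : ℕ} (hw : 0 < w)
    (h : (x / w + c) % m ≠ 0) : w ≤ (x + c * w) % (w * m) := by
  rw [Nat.mod_mul, Nat.add_mul_div_right _ _ hw]
  exact (Nat.le_mul_of_pos_right w (Nat.pos_of_ne_zero h)).trans (Nat.le_add_left _ _)

/-- Shifting by `-s` puts `y` between `x - 2 * s` and `x`, where residues do not wrap around. The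
added `N` avoids truncated subtraction. -/
lemma le_shift_mod {x y w s N : ℕ} (hsN : s ≤ N) (hw : w ≤ x % N) (hsw : 2 * s ≤ w)
    (hN : 0 < N) (hxy : ((y : ℤ) - (x : ℤ)).natAbs ≤ s) : w - 2 * s ≤ (y + N - s) % N := by
  have h1 := Nat.div_add_mod x N
  have h2 := Nat.mod_lt x hN
  set ρ := x % N
  have h3 : y + N - s = N * (x / N + 1) + (ρ + y - x - s) := by
    rw [Nat.mul_add, mul_one]
    omega
  rw [h3, Nat.mul_add_mod, Nat.mod_eq_of_lt (by omega)]
  omega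

/-- Crossing a multiple of `N` to or from a residue above `g` takes a step longer than `g`. -/
lemma div_eq_div_of_le_mod {x y g N : ℕ} (hx : g < x % N) (hy : g < y % N)
    (hxy : ((x : ℤ) - (y : ℤ)).natAbs ≤ g) : x / N = y / N := by
  have key : ∀ x y : ℕ, g < y % N → ((x : ℤ) - (y : ℤ)).natAbs ≤ g → 0 < N →
      y / N ≤ x / N := by
    intro x y hy hxy hN
    rw [Nat.le_div_iff_mul_le hN]
    have := Nat.div_add_mod' y N
    omega
  rcases Nat.eq_zero_or_pos N with rfl | hN
  · simp
  · exact (key y x hx (by omega) hN).antisymm (key x y hy hxy hN)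

lemma correctable_thicken_colorRegion {S : StabilizerCode (Site D L)} {ξ s d c : ℕ}
    (hloc : HasLocalGenerators S ξ) (hd : S.HasDistance d)
    (hlt : ((ξ + 2 * s + 1) * (D + 1)) ^ D < d) :
    S.Correctable (thicken s (colorRegion D L (ξ + 2 * s + 1) c)) := by
  set w := ξ + 2 * s + 1 with hw
  set N := w * (D + 1) with hN
  have hwN : w ≤ N := Nat.le_mul_of_pos_right _ D.succ_pos
  have hmod : ∀ a ∈ thicken s (colorRegion D L w c), ∀ i,
      ξ < ((a i : ℕ) + c * w + N - s) % N := by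
    rintro a ⟨b, hb, hab⟩ i
    have h1 := le_mod_of_div_add_mod_ne_zero (by omega) (hb i)
    have h2 := siteDist_le_iff.1 hab i
    have h3 := le_shift_mod (x := (b i : ℕ) + c * w) (y := (a i : ℕ) + c * w) (s := s)
      (N := N) (by omega) h1 (by omega) (by omega) (by push_cast; omega)
    omega
  -- Boxes are labelled by the quotients of the shifted coordinates. Residues exceed `ξ` because `w
  -- - 2 * s = ξ + 1`, and they determine a site within its box, which bounds the box by `N ^ D`.
  refine correctable_of_fibers hloc hd
    (fun a i => ((a i : ℕ) + c * w + N - s) / N) ?_ ?_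
  · intro a ha b hb hab
    funext i
    have h2 := siteDist_le_iff.1 hab i
    exact div_eq_div_of_le_mod (hmod a ha i) (hmod b hb i) (by omega)
  · intro t
    refine lt_of_le_of_lt ?_ hlt
    have hN0 : 0 < N := by omega
    have hcard : Nat.card (Fin D → Fin N) = N ^ D := by simp
    rw [← hcard, ← Set.ncard_univ]
    refine Set.ncard_le_ncard_of_injOn
      (fun a i => (⟨((a i : ℕ) + c * w + N - s) % N, Nat.mod_lt _ hN0⟩ : Fin N))
      (fun _ _ => Set.mem_univ _) ?_
    intro a ha b hb hab
    funext i
    have h1 := congrFun (ha.2.trans hb.2.symm) i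
    have h2 := congrArg Fin.val (congrFun hab i)
    simp only at h1 h2
    have h3 := Nat.div_add_mod ((a i : ℕ) + c * w + N - s) N
    have h4 := Nat.div_add_mod ((b i : ℕ) + c * w + N - s) N
    rw [h1, h2] at h3
    exact Fin.ext (by omega)

/-! ### Locality-preserving morphisms and the Clifford hierarchy -/

lemma notMem_supp_conj {K : Op (Site D L)} {s : ℕ} (hK : Spreads s K) {A : Set (Site D L)}
    {w : PauliLabel (Site D L)} (hw : ∀ a ∈ thicken s A, w a = 0) {a : Site D L} (ha : a ∈ A) :
    a ∉ supp (K * pauliOp w * Kᴴ) := by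
  intro h
  obtain ⟨b, hb, hab⟩ := (hK _).1 h
  exact mem_supp_pauliOp.1 hb (hw b ⟨a, ha, by rwa [siteDist_comm]⟩)

/-- The commutator is `K` times a Pauli conjugate of `Kᴴ`, and that conjugation does not enlarge
supports. Triviality on earlier regions therefore persists. -/
lemma supp_commutator_subset (K : Op (Site D L)) (w : PauliLabel (Site D L)) :
    supp (K * pauliOp w * Kᴴ * pauliOp w) ⊆ supp K := by
  have e : K * pauliOp w * Kᴴ * pauliOp w = K * (pauliOp w * Kᴴ * (pauliOp w)ᴴ) := by
    rw [pauliOp_conjTranspose]; simp only [mul_assoc]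
  rw [e]
  refine (supp_mul_subset _ _).trans (Set.union_subset subset_rfl ?_)
  refine ((spreads_pauliOp w _).1).trans ?_
  rw [supp_conjTranspose]
  rintro a ⟨b, hb, hab⟩
  have hab' := siteDist_le_iff.1 hab
  have : a = b := funext fun i => Fin.ext (by have := hab' i; omega)
  rwa [this]

/-- A locality-preserving logical operator that acts trivially on `j` of `D + 1` correctable
regions covering the lattice implements an element of level `D - j` of the Clifford hierarchy. -/
lemma comp_mem_cliffordLevel_of_spreads {S : StabilizerCode (Site D L)} {k : ℕ}
    {J : Matrix (Bits (Site D L)) (Bits (Fin k)) ℂ} (hJ : S.IsEncoding J)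
    {A : ℕ → Set (Site D L)} {σ : ℕ} (hA : ∀ j, S.Correctable (thicken σ (A j)))
    (hcover : ∀ a, ∃ j ≤ D, a ∈ A j) (n : ℕ) :
    ∀ (K : Op (Site D L)) (j s : ℕ), j + (n + 1) = D → 2 ^ n * s ≤ σ → Spreads s K →
      S.IsLogical K → (∀ i < j, ∀ a ∈ A i, a ∉ supp K) →
      Jᴴ * K * J ∈ cliffordLevel (Fin k) (n + 1) := by
  induction n with
  | zero =>
    intro K j s hj hs hK hlog hsupp
    refine mem_pauliGroup_of_mul_eq_smul (hJ.comp_mem_unitaryGroup hJ hlog) fun v => ?_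
    obtain ⟨w, hw, hwA, γ, hγ, e⟩ := hJ.exists_clean (hA j) (pauliOp_mem v)
    have hwlog : IsMorphism S S (pauliOp w) := hw.isLogical
    have hlog' : IsMorphism S S K := hlog
    have hwA' : ∀ a ∈ thicken s (A j), w a = 0 :=
      fun a ha => hwA a (thicken_mono (by simpa using hs) subset_rfl ha)
    -- Regions before `j` are excluded by `K` and region `j` by cleaning; since `j + 1 = D`, only
    -- the last region remains.
    have hK' : supp (K * pauliOp w * Kᴴ * pauliOp w) ⊆ thicken σ (A D) := by
      refine Set.Subset.trans ?_ (subset_thicken σ _)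
      intro a ha
      obtain ⟨i, hi, hai⟩ := hcover a
      rcases lt_trichotomy i j with h | rfl | h
      · exact absurd (supp_commutator_subset K w ha) (hsupp i h a hai)
      · rcases supp_mul_subset _ _ ha with h | h
        · exact absurd h (notMem_supp_conj hK hwA' hai)
        · exact absurd (hwA' a (subset_thicken _ _ hai)) (mem_supp_pauliOp.1 h)
      · have hiD : i = D := by omega
        rwa [hiD] at hai
    obtain ⟨c, hc⟩ := hJ.exists_eq_smul_one (hA D) hK'
    refine ⟨c, ?_⟩
    have hm := (hwlog.mul hlog')
    have e1 : Jᴴ * (K * pauliOp w) * J = c • (Jᴴ * (pauliOp w * K) * J) := by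
      have e2 : K * pauliOp w = (K * pauliOp w * Kᴴ * pauliOp w) * (pauliOp w * K) := by
        have h1 : K * pauliOp w * Kᴴ * pauliOp w * (pauliOp w * K) =
            K * pauliOp w * (Kᴴ * (pauliOp w * pauliOp w) * K) := by simp only [mul_assoc]
        rw [h1, pauliOp_mul_self, mul_one, conjTranspose_mul_of_mem hlog'.1, mul_one]
      conv_lhs => rw [e2]
      rw [hJ.mul_comp hJ hm, hc, Matrix.smul_mul, Matrix.one_mul]
    rw [e, Matrix.mul_smul, Matrix.smul_mul, ← hJ.mul_comp hJ hwlog, ← hJ.mul_comp hJ hlog', e1,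
      smul_comm]
  | succ n ih =>
    intro K j s hj hs hK hlog hsupp
    refine ⟨hJ.comp_mem_unitaryGroup hJ hlog, fun P hP => ?_⟩
    obtain ⟨w, hw, hwA, γ, hγ, e⟩ := hJ.exists_clean (hA j) hP
    have hwlog : IsMorphism S S (pauliOp w) := hw.isLogical
    have hlog' : IsMorphism S S K := hlog
    have hsσ : s ≤ σ := le_trans (Nat.le_mul_of_pos_left _ (by positivity)) hs
    have hwA' : ∀ a ∈ thicken s (A j), w a = 0 :=
      fun a ha => hwA a (thicken_mono hsσ subset_rfl ha)
    have hm1 : IsMorphism S S (K * pauliOp w * Kᴴ) := (hlog'.mul hwlog).mul hlog'.conjTranspose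
    -- The commutator contains `K` and `Kᴴ`, so its spread is `2 * s`; the budget `2 ^ n * s`
    -- absorbs the doubling.
    have h1 := ih (K * pauliOp w * Kᴴ * pauliOp w) (j + 1) (2 * s) (by omega)
      (by rw [← mul_assoc, ← pow_succ]; exact hs)
      (by
        have := ((hK.mul (spreads_pauliOp w)).mul hK.conjTranspose).mul (spreads_pauliOp w)
        rwa [show s + 0 + s + 0 = 2 * s by ring] at this)
      (hm1.mul hwlog) (by
        intro i hi a hai ha
        rcases Nat.lt_succ_iff_lt_or_eq.1 hi with h | rfl
        · exact hsupp i h a hai (supp_commutator_subset K w ha)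
        · rcases supp_mul_subset _ _ ha with h | h
          · exact notMem_supp_conj hK hwA' hai h
          · exact mem_supp_pauliOp.1 h (hwA' a (subset_thicken _ _ hai)))
    have h2 := mul_mem_cliffordLevel n h1 hP
    have e1 : Jᴴ * (K * pauliOp w * Kᴴ * pauliOp w) * J * P =
        (Jᴴ * K * J) * P * (Jᴴ * K * J)ᴴ := by
      rw [e, StabilizerCode.IsEncoding.conjTranspose_comp, Matrix.mul_smul, Matrix.mul_smul,
        Matrix.smul_mul, ← hJ.mul_comp hJ hwlog, ← hJ.mul_comp hJ hwlog,
        ← hJ.mul_comp hJ hlog'.conjTranspose, mul_assoc _ (pauliOp w) (pauliOp w),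
        pauliOp_mul_self, mul_one]
    rwa [e1] at h2

/-- Locality-preserving morphisms between codes of sufficiently large distance implement elements
of level `D` of the Clifford hierarchy. -/
lemma implementsLevel_of_spreads (hD : 2 ≤ D) {S₁ S₂ : StabilizerCode (Site D L)} {ξ ρ d k : ℕ}
    (hl₁ : HasLocalGenerators S₁ ξ) (hl₂ : HasLocalGenerators S₂ ξ)
    (hd₁ : S₁.HasDistance d) (hd₂ : S₂.HasDistance d)
    (hlt : ((ξ + 2 * (2 ^ D * ρ) + 1) * (D + 1)) ^ D < d)
    {J₁ J₂ : Matrix (Bits (Site D L)) (Bits (Fin k)) ℂ}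
    (hJ₁ : S₁.IsEncoding J₁) (hJ₂ : S₂.IsEncoding J₂) {U : Op (Site D L)}
    (hU : Spreads ρ U) (hm : IsMorphism S₁ S₂ U) : ImplementsLevel J₁ J₂ U D := by
  obtain ⟨n, rfl⟩ : ∃ n, D = n + 2 := ⟨D - 2, by omega⟩
  set σ := 2 ^ (n + 2) * ρ with hσ
  set A := colorRegion (n + 2) L (ξ + 2 * σ + 1)
  refine ⟨hJ₁.comp_mem_unitaryGroup hJ₂ hm, fun P hP => ?_⟩
  obtain ⟨w, hw, hwA, γ, hγ, e⟩ :=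
    hJ₁.exists_clean (M := thicken σ (A 0)) (correctable_thicken_colorRegion hl₁ hd₁ hlt) hP
  have hwlog : IsMorphism S₁ S₁ (pauliOp w) := hw.isLogical
  have hρσ : ρ ≤ σ := Nat.le_mul_of_pos_left _ (by positivity)
  -- Conjugation by `U` moves the problem to `S₂` with one region cleared. The doublings reach `2 ^
  -- n * (2 * ρ)`, which is at most `σ`.
  have h1 := comp_mem_cliffordLevel_of_spreads hJ₂ (A := A)
    (fun _ => correctable_thicken_colorRegion hl₂ hd₂ hlt) (exists_mem_colorRegion _) n
    (U * pauliOp w * Uᴴ) 1 (2 * ρ) (by omega)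
    (by rw [hσ, ← mul_assoc, ← pow_succ]; gcongr <;> omega)
    (by
      have := (hU.mul (spreads_pauliOp w)).mul hU.conjTranspose
      rwa [show ρ + 0 + ρ = 2 * ρ by ring] at this)
    ((hm.mul hwlog).mul hm.conjTranspose) (by
      intro i hi a hai
      obtain rfl : i = 0 := by omega
      exact notMem_supp_conj hU (fun a ha => hwA a (thicken_mono hρσ subset_rfl ha)) hai)
  have hPJ : J₂ᴴ * U * J₁ * P * (J₂ᴴ * U * J₁)ᴴ =
      γ • (J₂ᴴ * (U * pauliOp w * Uᴴ) * J₂) := by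
    rw [e, StabilizerCode.IsEncoding.conjTranspose_comp, Matrix.mul_smul, Matrix.smul_mul,
      ← hJ₁.mul_comp hJ₁ hwlog, ← hJ₂.mul_comp hJ₁ hm.conjTranspose]
  rw [hPJ]
  -- The phase `γ` is absorbed as right multiplication by the Pauli operator `γ • 1`.
  have h2 := mul_mem_cliffordLevel n h1
    (smul_mem_pauliGroup hγ (pauliOp_zero (Q := Fin k) ▸ pauliOp_mem 0))
  rwa [Matrix.mul_smul, Matrix.mul_one] at h2

/-! ### Clifford gates and the explicit constant -/

/-- A unitary in the second level of the hierarchy together with its inverse is Clifford. -/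
lemma mem_cliffordGroup {Q : Type} [Fintype Q] [DecidableEq Q] {U : Op Q}
    (h : U ∈ cliffordLevel Q 2) (h' : Uᴴ ∈ cliffordLevel Q 2) : U ∈ cliffordGroup Q := by
  refine ⟨h.1, Set.Subset.antisymm ?_ fun P hP => ⟨Uᴴ * P * U, ?_, ?_⟩⟩
  · rintro _ ⟨P, hP, rfl⟩
    exact h.2 P hP
  · have := h'.2 P hP
    rwa [Matrix.conjTranspose_conjTranspose] at this
  · have hu := mul_conjTranspose_of_mem h.1
    calc U * (Uᴴ * P * U) * Uᴴ = (U * Uᴴ) * P * (U * Uᴴ) := by simp only [mul_assoc]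
      _ = P := by rw [hu, one_mul, mul_one]

lemma HasLocalGenerators.mono {S : StabilizerCode (Site D L)} {ξ ξ' : ℕ}
    (h : HasLocalGenerators S ξ) (hle : ξ ≤ ξ') : HasLocalGenerators S ξ' := by
  obtain ⟨G, hG, hd⟩ := h
  exact ⟨G, hG, fun g hg a ha b hb => (hd g hg a ha b hb).trans hle⟩

lemma exists_distance_constant (D : ℕ) (hD : 2 ≤ D) :
    ∃ C : ℕ, ∀ (L ξ h r d : ℕ) (S₁ S₂ : StabilizerCode (Site D L)),
      HasLocalGenerators S₁ ξ → HasLocalGenerators S₂ ξ →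
      S₁.HasDistance d → S₂.HasDistance d →
      C * (ξ + h * r + 1) ^ D ≤ d →
      ∀ (k : ℕ) (J₁ J₂ : Matrix (Bits (Site D L)) (Bits (Fin k)) ℂ),
        S₁.IsEncoding J₁ → S₂.IsEncoding J₂ →
        ∀ U : Op (Site D L), IsCircuit h r U → IsMorphism S₁ S₂ U →
          ImplementsLevel J₁ J₂ U D ∧
            (D = 2 → J₂ᴴ * U * J₁ ∈ cliffordGroup (Fin k)) := by
  -- The box side is at most `2 ^ (D + 1) * (D + 1) * (ξ + h * r + 1)`; the final `+ 1` makes the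
  -- comparison with `d` strict.
  refine ⟨(2 ^ (D + 1) * (D + 1)) ^ D + 1, ?_⟩
  intro L ξ h r d S₁ S₂ hl₁ hl₂ hd₁ hd₂ hC k J₁ J₂ hJ₁ hJ₂ U hU hm
  have hlt : ((ξ + 2 * (2 ^ D * (h * r)) + 1) * (D + 1)) ^ D < d := by
    refine lt_of_lt_of_le ?_ hC
    have h1 : ξ + 2 * (2 ^ D * (h * r)) + 1 ≤ 2 ^ (D + 1) * (ξ + h * r + 1) := by
      have h2 : 1 ≤ 2 ^ (D + 1) := Nat.one_le_two_pow
      have h3 : ξ + 1 ≤ 2 ^ (D + 1) * (ξ + 1) := Nat.le_mul_of_pos_left _ h2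
      have h4 : 2 ^ (D + 1) * (ξ + h * r + 1) =
          2 ^ (D + 1) * (ξ + 1) + 2 * (2 ^ D * (h * r)) := by ring
      omega
    have h2 : ((ξ + 2 * (2 ^ D * (h * r)) + 1) * (D + 1)) ^ D ≤
        (2 ^ (D + 1) * (D + 1)) ^ D * (ξ + h * r + 1) ^ D := by
      rw [← mul_pow]
      refine Nat.pow_le_pow_left ?_ D
      calc _ ≤ 2 ^ (D + 1) * (ξ + h * r + 1) * (D + 1) := Nat.mul_le_mul_right _ h1
        _ = _ := by ring
    have h3 : 0 < (ξ + h * r + 1) ^ D := by positivity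
    exact h2.trans_lt (Nat.mul_lt_mul_of_pos_right (Nat.lt_succ_self _) h3)
  have hs := hU.spreads
  have main := implementsLevel_of_spreads hD hl₁ hl₂ hd₁ hd₂ hlt hJ₁ hJ₂ hs hm
  refine ⟨main, ?_⟩
  rintro rfl
  refine mem_cliffordGroup main ?_
  rw [StabilizerCode.IsEncoding.conjTranspose_comp]
  exact implementsLevel_of_spreads hD hl₂ hl₁ hd₂ hd₁ hlt hJ₂ hJ₁ hs.conjTranspose
    hm.conjTranspose

end LocalStab

theorem theorem1 (D : ℕ) (hD : 2 ≤ D) :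
    -- quantitative form for a single pair of codes; `C` depends only on `D`
    (∃ C : ℕ, ∀ (L ξ h r d : ℕ) (S₁ S₂ : StabilizerCode (Site D L)),
      HasLocalGenerators S₁ ξ → HasLocalGenerators S₂ ξ →
      S₁.HasDistance d → S₂.HasDistance d →
      C * (ξ + h * r + 1) ^ D ≤ d →
      ∀ (k : ℕ) (J₁ J₂ : Matrix (Bits (Site D L)) (Bits (Fin k)) ℂ),
        S₁.IsEncoding J₁ → S₂.IsEncoding J₂ →
        ∀ U : Op (Site D L), IsCircuit h r U → IsMorphism S₁ S₂ U →
          ImplementsLevel J₁ J₂ U D ∧ (D = 2 → J₂ᴴ * U * J₁ ∈ cliffordGroup (Fin k))) ∧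
    -- morphisms between topological stabilizer codes
    (∀ (L : ℕ → ℕ) (S₁ S₂ : ∀ m, StabilizerCode (Site D (L m))),
      IsTopologicalStabilizerCode L S₁ → IsTopologicalStabilizerCode L S₂ →
      ∀ h r : ℕ, ∀ᶠ m in atTop,
        ∀ (k : ℕ) (J₁ J₂ : Matrix (Bits (Site D (L m))) (Bits (Fin k)) ℂ),
          (S₁ m).IsEncoding J₁ → (S₂ m).IsEncoding J₂ →
          ∀ U : Op (Site D (L m)), IsCircuit h r U → IsMorphism (S₁ m) (S₂ m) U →
            ImplementsLevel J₁ J₂ U D ∧ (D = 2 → J₂ᴴ * U * J₁ ∈ cliffordGroup (Fin k))) ∧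
    -- logical operators of one topological stabilizer code
    (∀ (L : ℕ → ℕ) (S : ∀ m, StabilizerCode (Site D (L m))),
      IsTopologicalStabilizerCode L S →
      ∀ h r : ℕ, ∀ᶠ m in atTop,
        ∀ (k : ℕ) (J : Matrix (Bits (Site D (L m))) (Bits (Fin k)) ℂ),
          (S m).IsEncoding J →
          ∀ U : Op (Site D (L m)), IsCircuit h r U → (S m).IsLogical U →
            ImplementsLevel J J U D ∧ (D = 2 → Jᴴ * U * J ∈ cliffordGroup (Fin k))) := by
  have part₁ := exists_distance_constant D hD
  have part₂ : ∀ (L : ℕ → ℕ) (S₁ S₂ : ∀ m, StabilizerCode (Site D (L m))),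
      IsTopologicalStabilizerCode L S₁ → IsTopologicalStabilizerCode L S₂ →
      ∀ h r : ℕ, ∀ᶠ m in atTop,
        ∀ (k : ℕ) (J₁ J₂ : Matrix (Bits (Site D (L m))) (Bits (Fin k)) ℂ),
          (S₁ m).IsEncoding J₁ → (S₂ m).IsEncoding J₂ →
          ∀ U : Op (Site D (L m)), IsCircuit h r U → IsMorphism (S₁ m) (S₂ m) U →
            ImplementsLevel J₁ J₂ U D ∧
              (D = 2 → J₂ᴴ * U * J₁ ∈ cliffordGroup (Fin k)) := by
    obtain ⟨C, hC⟩ := part₁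
    rintro L S₁ S₂ ⟨-, ⟨ξ₁, hl₁⟩, hd₁⟩ ⟨-, ⟨ξ₂, hl₂⟩, hd₂⟩ h r
    -- The required distance is a constant independent of `m`, with the larger range serving both
    -- codes.
    filter_upwards [hd₁ (C * (max ξ₁ ξ₂ + h * r + 1) ^ D),
      hd₂ (C * (max ξ₁ ξ₂ + h * r + 1) ^ D)] with m hm₁ hm₂
    exact hC (L m) (max ξ₁ ξ₂) h r _ (S₁ m) (S₂ m) ((hl₁ m).mono (le_max_left _ _))
      ((hl₂ m).mono (le_max_right _ _)) hm₁ hm₂ le_rfl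
  refine ⟨part₁, part₂, fun L S hS h r => ?_⟩
  filter_upwards [part₂ L S S hS hS h r] with m hm k J hJ U hU hlog
  exact hm k J J hJ hJ U hU hlog
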